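/- **Setting.** Let $\tilde\gamma>0$ and let $\gamma^{(N)}_1,\dots,\gamma^{(N)}_N\in[0,\tilde\gamma]$, $N\ge 1$, be a triangular array of eigenvalues whose empirical measures $\frac1N\sum_{i\le N}\delta_{\gamma^{(N)}_i}$ converge in the 1-Wasserstein metric to a probability measure $\rho$. (These are the eigenvalues of the rotationally invariant coupling matrix of the symmetric spherical model, written in the eigenbasis.) We write $\gamma_i$ for $\gamma_i^{(N)}$. For $z\in\mathbb R\setminus[0,\tilde\gamma]$ let $S_\rho(z)=\int_{[0,\tilde\gamma]}\frac{\rho(d\gamma)}{z-\gamma}$, and let $S_{\max}=\lim_{z\downarrow\tilde\gamma}S_\rho(z)\in(0,+\infty]$, $S_{\min}=\lim_{z\uparrow0}S_\rho(z)\in[-\infty,0)$. Then $S_\rho$ is a bijection from $\mathbb R\setminus[0,\tilde\gamma]$ onto $(S_{\min},S_{\max})\setminus\{0\}$; let $K_\rho$ be its inverse, $R_\rho(x)=K_\rho(x)-1/x$, $T_\rho=(S_{\min}/2,S_{\max}/2)\setminus\{0\}$, and $v(\theta)=R_\rho(2\theta)$ for $\theta\in T_\rho$. Let $G$ be the standard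 normal measure on $\mathbb R^N$. For a Hamiltonian $H:\mathbb R^N\to\mathbb R$, its Gibbs mean at (inverse) temperature $\theta$ is $f\mapsto \int f e^{\theta H}\,dG\big/\int e^{\theta H}\,dG$. Let $\langle\cdot\rangle$ be the Gibbs mean of $$H_N(g)=N\sum_{i\le N}\gamma_i\frac{g_i^2}{\|g\|^2},$$ and, for $d\le N$, let $\langle\cdot\rangle_d$ be the Gibbs mean of $$H_d(g)=N\sum_{i\le N,\,i\ne d}\gamma_i\frac{g_i^2}{\|\bar g\|^2}-(v(\theta)-\gamma_d)\,g_d^2,$$ where $\bar g\in\mathbb R^{N-1}$ is $g$ without its $d$-th coordinate (for $N=1$ the sum is empty). Put $h_N=H_N/N$ and $a_N(\theta)=\langle(h_N-v(\theta))^2\rangle$. **Theorem (Decoupling in the high-temperature phase).** Let $\theta\in T_\rho$. 1. There is a constant $K(\theta)>0$, independent of $N$, $d$ and $f$, such that for all $N\ge1$, all $d\in\{1,\dots,N\}$ and all bounded measurable $f:\mathbb R^N\to\mathbb R$, $$\big|\langle f\rangle-\langle f\rangle_d\big|\le K(\theta)\,\|f\|_\infty\Big(\frac1{\sqrt N}+\sqrt{a_N(\theta)}\Big),\qquad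 \|f\|_\infty=\sup_{g}|f(g)|.$$ 2. For all $N\ge1$ and $d\in\{1,\dots,N\}$, under the Gibbs measure of $H_d$ the $d$-th coordinate is an independent Gaussian: $1+2\theta(v(\theta)-\gamma_d)>0$, $e^{\theta H_d}$ is $G$-integrable, and for all bounded measurable $\varphi:\mathbb R\to\mathbb R$ and $\psi:\mathbb R^{N-1}\to\mathbb R$, $$\langle\varphi(g_d)\,\psi(\bar g)\rangle_d=\Big(\int_{\mathbb R}\varphi\,d\mu_{\gamma_d}\Big)\,\langle\psi(\bar g)\rangle_d,$$ where $\mu_{\gamma_d}$ is the centred normal law of variance $1/(1+2\theta(v(\theta)-\gamma_d))$. -/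

import Mathlib

open MeasureTheory ProbabilityTheory Filter Topology
open scoped ENNReal NNReal

noncomputable section

namespace SphericalModel

/-- The 1-Wasserstein distance between two measures on `ℝ`: the infimum of the transport cost
`∫ |x - y| dπ(x, y)` over all couplings `π`. -/
def wasserstein1 (μ ν : Measure ℝ) : ℝ≥0∞ :=
  ⨅ (π : Measure (ℝ × ℝ)) (_ : π.map Prod.fst = μ) (_ : π.map Prod.snd = ν),
    ∫⁻ p, edist p.1 p.2 ∂π

/-- The empirical measure `N⁻¹ ∑ᵢ δ_{γᵢ}`. -/
def empiricalMeasure {N : ℕ} (γ : Fin N → ℝ) : Measure ℝ :=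
  (N : ℝ≥0∞)⁻¹ • ∑ i, Measure.dirac (γ i)

/-- Hypothesis on the triangular array of eigenvalues `γ N i` (`i < N`): all of them lie in
`[0, γt]`, and their empirical measures converge to `ρ` in the 1-Wasserstein metric. -/
structure EigenvalueHypothesis (γt : ℝ) (γ : (N : ℕ) → Fin N → ℝ) (ρ : Measure ℝ) : Prop where
  mem_Icc : ∀ N i, γ N i ∈ Set.Icc 0 γt
  tendsto : Tendsto (fun N => wasserstein1 (empiricalMeasure (γ N)) ρ) atTop (𝓝 0)

/-- The Stieltjes transform `S_ρ(z) = ∫_{[0, γt]} ρ(dγ) / (z - γ)`, used for `z ∉ [0, γt]`. -/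
def stieltjes (γt : ℝ) (ρ : Measure ℝ) (z : ℝ) : ℝ :=
  ∫ x in Set.Icc 0 γt, 1 / (z - x) ∂ρ

/-- `S_max = lim_{z ↓ γt} S_ρ(z)`, possibly `+∞`. -/
def Smax (γt : ℝ) (ρ : Measure ℝ) : EReal :=
  limUnder (𝓝[>] γt) (fun z => (stieltjes γt ρ z : EReal))

/-- `S_min = lim_{z ↑ 0} S_ρ(z)`, possibly `-∞`. -/
def Smin (γt : ℝ) (ρ : Measure ℝ) : EReal :=
  limUnder (𝓝[<] (0 : ℝ)) (fun z => (stieltjes γt ρ z : EReal))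

/-- `K_ρ`: the inverse of the bijection `S_ρ : ℝ \ [0, γt] → (S_min, S_max) \ {0}`. -/
def Kinv (γt : ℝ) (ρ : Measure ℝ) : ℝ → ℝ :=
  Function.invFunOn (stieltjes γt ρ) (Set.Icc 0 γt)ᶜ

/-- The R-transform `R_ρ(x) = K_ρ(x) - 1 / x`, used for `x ∈ (S_min, S_max) \ {0}`. -/
def Rtransform (γt : ℝ) (ρ : Measure ℝ) (x : ℝ) : ℝ :=
  Kinv γt ρ x - 1 / x

/-- The high-temperature region `T_ρ = (S_min / 2, S_max / 2) \ {0}`. -/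
def highTemp (γt : ℝ) (ρ : Measure ℝ) : Set ℝ :=
  {θ | Smin γt ρ < ((2 * θ : ℝ) : EReal) ∧ ((2 * θ : ℝ) : EReal) < Smax γt ρ ∧ θ ≠ 0}

/-- The limiting intensive energy `v(θ) = R_ρ(2θ)`. -/
def vlim (γt : ℝ) (ρ : Measure ℝ) (θ : ℝ) : ℝ :=
  Rtransform γt ρ (2 * θ)

/-- The standard normal measure `G` on `ℝᴺ`. -/
def stdNormal (N : ℕ) : Measure (Fin N → ℝ) :=
  Measure.pi fun _ => gaussianReal 0 1

/-- The Gibbs mean at temperature `θ` of `f` for the Hamiltonian `H`, with respect to the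
standard normal measure. -/
def gibbsMean {N : ℕ} (θ : ℝ) (H f : (Fin N → ℝ) → ℝ) : ℝ :=
  (∫ g, Real.exp (θ * H g) ∂stdNormal N)⁻¹ *
    ∫ g, f g * Real.exp (θ * H g) ∂stdNormal N

/-- The Hamiltonian `H_N(g) = N ∑ᵢ γᵢ gᵢ² / ‖g‖²` (Euclidean norm). -/
def HN {N : ℕ} (γ : Fin N → ℝ) (g : Fin N → ℝ) : ℝ :=
  N * ∑ i, γ i * (g i ^ 2 / ∑ j, g j ^ 2)

/-- The intensive energy `h_N = H_N / N`. -/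
def hN {N : ℕ} (γ : Fin N → ℝ) (g : Fin N → ℝ) : ℝ :=
  HN γ g / N

/-- The Hamiltonian with the `d`-th spin decoupled,
`H_d(g) = N ∑_{i ≠ d} γᵢ gᵢ² / ‖ḡ‖² - (v - γ_d) g_d²`, where `ḡ` is `g` without its
`d`-th coordinate. -/
def Hd {N : ℕ} (γ : Fin N → ℝ) (v : ℝ) (d : Fin N) (g : Fin N → ℝ) : ℝ :=
  N * ∑ i ∈ Finset.univ.erase d, γ i * (g i ^ 2 / ∑ j ∈ Finset.univ.erase d, g j ^ 2)
    - (v - γ d) * g d ^ 2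

/-- `a_N(θ) = ⟨(h_N - v(θ))²⟩_θ`. -/
def aN (γt : ℝ) (ρ : Measure ℝ) {N : ℕ} (γ : Fin N → ℝ) (θ : ℝ) : ℝ :=
  gibbsMean θ (HN γ) fun g => (hN γ g - vlim γt ρ θ) ^ 2

end SphericalModel

end

open SphericalModel

/-!
Under the Gibbs measure of `H_N`, Gaussian integration by parts bounds the fluctuations of the
radius `‖ḡ‖² / N` around `1` and of the energy of the spins `ḡ` around `v` by a multiple of
`1 / √N + √a_N`. With `ḡ` fixed, the Boltzmann factors of `H_N` and `H_d` are functions of the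
single spin `g_d`: their exponents differ by a polynomial in `g_d` times these fluctuations, and
both factors stay integrable because `1 + 2θ(v - γ_d) > 0`. Integrating out `g_d` leaves averages
over `ḡ` with the decoupled weight. Where `‖ḡ‖²` is of order `N`, integrating `g_d` in the weight
of `H_N` costs at most a constant factor, so these averages are bounded by averages under the Gibbs
measure of `H_N`; where it is not, Chebyshev's inequality for the radius gives a factor `1 / N`.
-/

namespace SphericalModel

section Stieltjes

variable {γt : ℝ} {ρ : Measure ℝ}

lemma abs_stieltjes_le [IsFiniteMeasure ρ] {δ z : ℝ} (hδ : 0 < δ)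
    (h : ∀ x ∈ Set.Icc 0 γt, δ ≤ |z - x|) : |stieltjes γt ρ z| ≤ ρ.real (Set.Icc 0 γt) / δ := by
  rw [div_eq_inv_mul]
  refine norm_setIntegral_le_of_norm_le_const (f := fun x => 1 / (z - x)) (measure_lt_top ρ _)
    fun x hx => ?_
  rw [one_div, norm_inv]
  exact inv_anti₀ hδ (h x hx)

lemma exists_eventually_le_abs_sub {z : ℝ} (hz : z ∈ (Set.Icc 0 γt)ᶜ) :
    ∃ δ > 0, ∀ᶠ z' in 𝓝 z, ∀ x ∈ Set.Icc 0 γt, δ ≤ |z' - x| := by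
  obtain ⟨ε, hε, hball⟩ := Metric.isOpen_iff.1 isClosed_Icc.isOpen_compl z hz
  refine ⟨ε / 2, half_pos hε, ?_⟩
  filter_upwards [Metric.ball_mem_nhds z (half_pos hε)] with z' hz' x hx
  by_contra! hlt
  refine hball ?_ hx
  rw [Metric.mem_ball, dist_comm]
  linarith [dist_triangle z z' x, Real.dist_eq z' x, dist_comm z z', Metric.mem_ball.1 hz']

lemma integrableOn_one_div_sub [IsFiniteMeasure ρ] {z : ℝ} (hz : z ∈ (Set.Icc 0 γt)ᶜ) :
    IntegrableOn (fun x => 1 / (z - x)) (Set.Icc 0 γt) ρ := by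
  obtain ⟨δ, hδ, h⟩ := exists_eventually_le_abs_sub hz
  refine Integrable.of_bound (C := δ⁻¹) (Measurable.aestronglyMeasurable (by fun_prop)) ?_
  filter_upwards [ae_restrict_mem measurableSet_Icc] with x hx
  rw [one_div, norm_inv]
  exact inv_anti₀ hδ (h.self_of_nhds x hx)

lemma continuousOn_stieltjes [IsFiniteMeasure ρ] :
    ContinuousOn (stieltjes γt ρ) (Set.Icc 0 γt)ᶜ := by
  refine continuousOn_of_forall_continuousAt fun z hz => ?_
  obtain ⟨δ, hδ, h⟩ := exists_eventually_le_abs_sub hz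
  refine continuousAt_of_dominated (bound := fun _ => δ⁻¹)
    (.of_forall fun _ => Measurable.aestronglyMeasurable (by fun_prop)) ?_ (integrable_const _) ?_
  · filter_upwards [h] with z' hz'
    filter_upwards [ae_restrict_mem measurableSet_Icc] with x hx
    rw [one_div, norm_inv]
    exact inv_anti₀ hδ (hz' x hx)
  · filter_upwards [ae_restrict_mem measurableSet_Icc] with x hx
    have hzx : z - x ≠ 0 := sub_ne_zero.2 fun hzx => hz (hzx ▸ hx)
    fun_prop (disch := exact hzx)

lemma antitoneOn_stieltjes [IsFiniteMeasure ρ] {s : Set ℝ} [s.OrdConnected]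
    (hs : s ⊆ (Set.Icc 0 γt)ᶜ) : AntitoneOn (stieltjes γt ρ) s := by
  intro z hz z' hz' hle
  refine setIntegral_mono_on (integrableOn_one_div_sub (hs hz')) (integrableOn_one_div_sub (hs hz))
    measurableSet_Icc fun x hx => ?_
  have hx' : x ∉ Set.Icc z z' := fun h => hs (Set.Icc_subset s hz hz' h) hx
  rcases lt_or_ge x z with hxz | hzx
  · exact one_div_le_one_div_of_le (by linarith) (by linarith)
  · have hz'x : z' < x := not_le.1 fun h => hx' ⟨hzx, h⟩
    exact one_div_le_one_div_of_neg_of_le (by linarith) (by linarith)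

lemma tendsto_stieltjes_cobounded [IsFiniteMeasure ρ] :
    Tendsto (stieltjes γt ρ) (Bornology.cobounded ℝ) (𝓝 0) := by
  have hgrow : Tendsto (fun z : ℝ => ‖z‖ - γt) (Bornology.cobounded ℝ) atTop :=
    tendsto_atTop_add_const_right _ _ tendsto_norm_cobounded_atTop
  refine squeeze_zero_norm' ?_ (hgrow.const_div_atTop (ρ.real (Set.Icc 0 γt)))
  filter_upwards [hgrow.eventually_gt_atTop 0] with z hz
  refine abs_stieltjes_le hz fun x hx => ?_
  have habs : |x| ≤ γt := abs_le.2 ⟨by linarith [hx.1, hx.2], hx.2⟩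
  exact (sub_le_sub_left habs _).trans (abs_sub_abs_le_abs_sub z x)

lemma tendsto_stieltjes_Smax [IsFiniteMeasure ρ] :
    Tendsto (fun z => (stieltjes γt ρ z : EReal)) (𝓝[>] γt) (𝓝 (Smax γt ρ)) := by
  have hanti : AntitoneOn (fun z => (stieltjes γt ρ z : EReal)) (Set.Ioi γt) :=
    EReal.coe_strictMono.monotone.comp_antitoneOn
      (antitoneOn_stieltjes fun _ hz hz' => hz.not_ge hz'.2)
  exact tendsto_nhds_limUnder ⟨_, hanti.tendsto_nhdsGT (OrderTop.bddAbove _)⟩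

lemma tendsto_stieltjes_Smin [IsFiniteMeasure ρ] :
    Tendsto (fun z => (stieltjes γt ρ z : EReal)) (𝓝[<] 0) (𝓝 (Smin γt ρ)) := by
  have hanti : AntitoneOn (fun z => (stieltjes γt ρ z : EReal)) (Set.Iio 0) :=
    EReal.coe_strictMono.monotone.comp_antitoneOn
      (antitoneOn_stieltjes fun _ hz hz' => hz.not_ge hz'.1)
  exact tendsto_nhds_limUnder ⟨_, hanti.tendsto_nhdsLT (OrderBot.bddBelow _)⟩

lemma exists_stieltjes_eq [IsFiniteMeasure ρ] {t : ℝ} (hmin : Smin γt ρ < t)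
    (hmax : t < Smax γt ρ) (ht : t ≠ 0) : ∃ z ∈ (Set.Icc 0 γt)ᶜ, stieltjes γt ρ z = t := by
  have hcont : ContinuousOn (fun z => (stieltjes γt ρ z : EReal)) (Set.Icc 0 γt)ᶜ :=
    continuous_coe_real_ereal.comp_continuousOn continuousOn_stieltjes
  have hzero : Tendsto (fun z => (stieltjes γt ρ z : EReal)) (Bornology.cobounded ℝ) (𝓝 0) :=
    (continuous_coe_real_ereal.tendsto 0).comp tendsto_stieltjes_cobounded
  rcases lt_or_gt_of_ne ht with hneg | hpos
  · have hsub : Set.Iio 0 ⊆ (Set.Icc 0 γt)ᶜ := fun z hz hz' => (Set.mem_Iio.1 hz).not_ge hz'.1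
    obtain ⟨z, hz, hzt⟩ := isPreconnected_Iio.intermediate_value_Ioo
      (l₁ := 𝓝[<] 0) inf_le_right (le_principal_iff.2 (Iio_mem_atBot 0))
      (hcont.mono hsub) tendsto_stieltjes_Smin
      (hzero.mono_left IsOrderBornology.atBot_le_cobounded) ⟨hmin, by exact_mod_cast hneg⟩
    exact ⟨z, hsub hz, EReal.coe_injective hzt⟩
  · have hsub : Set.Ioi γt ⊆ (Set.Icc 0 γt)ᶜ := fun z hz hz' => (Set.mem_Ioi.1 hz).not_ge hz'.2
    obtain ⟨z, hz, hzt⟩ := isPreconnected_Ioi.intermediate_value_Ioo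
      (l₂ := 𝓝[>] γt) (le_principal_iff.2 (Ioi_mem_atTop γt)) inf_le_right
      (hcont.mono hsub) (hzero.mono_left IsOrderBornology.atTop_le_cobounded)
      tendsto_stieltjes_Smax ⟨by exact_mod_cast hpos, hmax⟩
    exact ⟨z, hsub hz, EReal.coe_injective hzt⟩

lemma stieltjes_nonneg {z : ℝ} (hz : γt ≤ z) : 0 ≤ stieltjes γt ρ z :=
  setIntegral_nonneg measurableSet_Icc fun _ hx => one_div_nonneg.2 (by linarith [hx.2])

lemma stieltjes_nonpos {z : ℝ} (hz : z ≤ 0) : stieltjes γt ρ z ≤ 0 :=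
  setIntegral_nonpos measurableSet_Icc fun _ hx => one_div_nonpos.2 (by linarith [hx.1])

lemma mul_Kinv_sub_pos [IsFiniteMeasure ρ] {t x : ℝ} (hmin : Smin γt ρ < t)
    (hmax : t < Smax γt ρ) (ht : t ≠ 0) (hx : x ∈ Set.Icc 0 γt) : 0 < t * (Kinv γt ρ t - x) := by
  have hex := exists_stieltjes_eq hmin hmax ht
  have hmem : Kinv γt ρ t ∈ (Set.Icc 0 γt)ᶜ := Function.invFunOn_mem hex
  have heq : stieltjes γt ρ (Kinv γt ρ t) = t := Function.invFunOn_eq hex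
  rcases lt_or_ge (Kinv γt ρ t) 0 with hneg | hnonneg
  · have htneg : t < 0 := lt_of_le_of_ne (heq ▸ stieltjes_nonpos hneg.le) ht
    exact mul_pos_of_neg_of_neg htneg (by linarith [hx.1])
  · have hgt : γt < Kinv γt ρ t := not_le.1 fun h => hmem ⟨hnonneg, h⟩
    have htpos : 0 < t := lt_of_le_of_ne (heq ▸ stieltjes_nonneg hgt.le) ht.symm
    exact mul_pos htpos (by linarith [hx.2])

lemma exists_precision_lower_bound [IsFiniteMeasure ρ] {θ : ℝ} (hθ : θ ∈ highTemp γt ρ) :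
    ∃ c > 0, ∀ x ∈ Set.Icc 0 γt, c ≤ 1 + 2 * θ * (vlim γt ρ θ - x) := by
  obtain ⟨hmin, hmax, hne⟩ := hθ
  refine isCompact_Icc.exists_forall_le' (by fun_prop) fun x hx => ?_
  have hprec : 1 + 2 * θ * (vlim γt ρ θ - x) = 2 * θ * (Kinv γt ρ (2 * θ) - x) := by
    unfold vlim Rtransform
    field_simp
    ring
  rw [hprec]
  exact mul_Kinv_sub_pos hmin hmax (by simpa using hne) hx

end Stieltjes

section GaussianTilt

variable {b : ℝ}

lemma gaussianReal_withDensity_exp_neg_sq (hb : 0 < 1 + 2 * b) :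
    (gaussianReal 0 1).withDensity (fun x => ENNReal.ofReal (Real.exp (-(b * x ^ 2)))) =
      ENNReal.ofReal (√(1 + 2 * b))⁻¹ • gaussianReal 0 (Real.toNNReal (1 / (1 + 2 * b))) := by
  have hv : Real.toNNReal (1 / (1 + 2 * b)) ≠ 0 := by
    rw [Ne, Real.toNNReal_eq_zero, not_le]; positivity
  rw [gaussianReal_of_var_ne_zero 0 one_ne_zero, gaussianReal_of_var_ne_zero 0 hv,
    ← withDensity_mul _ (measurable_gaussianPDF _ _) (by fun_prop),
    ← withDensity_smul _ (measurable_gaussianPDF _ _)]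
  congr 1
  ext x
  simp only [Pi.mul_apply, Pi.smul_apply, smul_eq_mul, gaussianPDF, gaussianPDFReal]
  rw [← ENNReal.ofReal_mul (by positivity), ← ENNReal.ofReal_mul (by positivity)]
  congr 1
  rw [Real.coe_toNNReal _ (by positivity), mul_assoc, ← Real.exp_add, ← mul_assoc, ← mul_inv,
    ← Real.sqrt_mul hb.le]
  congr 1
  · congr 2
    push_cast
    field_simp
  · congr 1
    push_cast
    field_simp
    ring

lemma integrable_exp_neg_sq_gaussianReal (hb : 0 < 1 + 2 * b) :
    Integrable (fun x => Real.exp (-(b * x ^ 2))) (gaussianReal 0 1) := by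
  refine ⟨by fun_prop, ?_⟩
  rw [hasFiniteIntegral_iff_ofReal (ae_of_all _ fun x => (Real.exp_pos _).le)]
  have h := congrArg (fun μ : Measure ℝ => μ Set.univ) (gaussianReal_withDensity_exp_neg_sq hb)
  simp only [withDensity_apply _ MeasurableSet.univ, Measure.restrict_univ] at h
  rw [h, Measure.smul_apply, measure_univ, smul_eq_mul, mul_one]
  exact ENNReal.ofReal_lt_top

lemma integral_mul_exp_neg_sq_gaussianReal (hb : 0 < 1 + 2 * b) (φ : ℝ → ℝ) :
    ∫ x, φ x * Real.exp (-(b * x ^ 2)) ∂gaussianReal 0 1 =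
      (√(1 + 2 * b))⁻¹ * ∫ x, φ x ∂gaussianReal 0 (Real.toNNReal (1 / (1 + 2 * b))) := by
  have h := congrArg (fun μ : Measure ℝ => ∫ x, φ x ∂μ) (gaussianReal_withDensity_exp_neg_sq hb)
  simp only [integral_smul_measure] at h
  rw [integral_withDensity_eq_integral_toReal_smul (by fun_prop)
    (ae_of_all _ fun _ => ENNReal.ofReal_lt_top), ENNReal.toReal_ofReal (by positivity),
    smul_eq_mul] at h
  rw [← h]
  congr 1 with x
  rw [ENNReal.toReal_ofReal (Real.exp_pos _).le, smul_eq_mul, mul_comm]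

lemma integral_exp_neg_sq_gaussianReal (hb : 0 < 1 + 2 * b) :
    ∫ x, Real.exp (-(b * x ^ 2)) ∂gaussianReal 0 1 = (√(1 + 2 * b))⁻¹ := by
  simpa using integral_mul_exp_neg_sq_gaussianReal hb fun _ => 1

end GaussianTilt

section StandardNormal

variable {n : ℕ} {d : Fin (n + 1)}

instance isProbabilityMeasure_stdNormal (n : ℕ) : IsProbabilityMeasure (stdNormal n) := by
  unfold stdNormal
  infer_instance

lemma measurePreserving_prodMk_removeNth :
    MeasurePreserving (fun g : Fin (n + 1) → ℝ => (g d, d.removeNth g)) (stdNormal (n + 1))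
      ((gaussianReal 0 1).prod (stdNormal n)) :=
  measurePreserving_piFinSuccAbove (fun _ => gaussianReal 0 1) d

lemma measurableEmbedding_prodMk_removeNth :
    MeasurableEmbedding fun g : Fin (n + 1) → ℝ => (g d, d.removeNth g) :=
  (MeasurableEquiv.piFinSuccAbove (fun _ => ℝ) d).measurableEmbedding

lemma integrable_mul_removeNth {φ : ℝ → ℝ} {ψ : (Fin n → ℝ) → ℝ}
    (hφ : Integrable φ (gaussianReal 0 1)) (hψ : Integrable ψ (stdNormal n)) :
    Integrable (fun g => φ (g d) * ψ (d.removeNth g)) (stdNormal (n + 1)) :=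
  measurePreserving_prodMk_removeNth.integrable_comp_of_integrable (hφ.mul_prod hψ)

lemma integral_mul_removeNth (φ : ℝ → ℝ) (ψ : (Fin n → ℝ) → ℝ) :
    ∫ g, φ (g d) * ψ (d.removeNth g) ∂stdNormal (n + 1) =
      (∫ x, φ x ∂gaussianReal 0 1) * ∫ y, ψ y ∂stdNormal n :=
  (measurePreserving_prodMk_removeNth.integral_comp measurableEmbedding_prodMk_removeNth
    fun p => φ p.1 * ψ p.2).trans (integral_prod_mul φ ψ)

lemma integrable_insertNth {u : (Fin (n + 1) → ℝ) → ℝ} (hu : Integrable u (stdNormal (n + 1))) :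
    Integrable (fun p : ℝ × (Fin n → ℝ) => u (d.insertNth p.1 p.2))
      ((gaussianReal 0 1).prod (stdNormal n)) := by
  refine ((measurePreserving_prodMk_removeNth (d := d)).integrable_comp_emb
    measurableEmbedding_prodMk_removeNth).1 ?_
  simpa [Function.comp_def] using hu

lemma integral_stdNormal_succ {u : (Fin (n + 1) → ℝ) → ℝ}
    (hu : Integrable u (stdNormal (n + 1))) :
    ∫ g, u g ∂stdNormal (n + 1) =
      ∫ y, ∫ x, u (d.insertNth x y) ∂gaussianReal 0 1 ∂stdNormal n := by
  rw [← integral_prod_symm _ (integrable_insertNth hu),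
    ← (measurePreserving_prodMk_removeNth (d := d)).integral_comp
      measurableEmbedding_prodMk_removeNth]
  simp

lemma ae_integrable_insertNth {u : (Fin (n + 1) → ℝ) → ℝ}
    (hu : Integrable u (stdNormal (n + 1))) :
    ∀ᵐ y ∂stdNormal n, Integrable (fun x => u (d.insertNth x y)) (gaussianReal 0 1) :=
  (integrable_insertNth hu).prod_left_ae

lemma ae_ne_zero_stdNormal [NeZero n] : ∀ᵐ y ∂stdNormal n, y ≠ 0 := by
  have := nullSingletonClass_gaussianReal (μ := 0) (v := 1) one_ne_zero
  filter_upwards [Measure.ae_eval_ne (fun _ : Fin n => gaussianReal 0 1) 0 0] with y hy hzero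
  exact hy (congrFun hzero 0)

end StandardNormal

section Stein

lemma integrable_gaussianPDFReal_mul {f : ℝ → ℝ} (hf : Integrable f (gaussianReal 0 1)) :
    Integrable (fun x => gaussianPDFReal 0 1 x * f x) := by
  rw [gaussianReal_of_var_ne_zero 0 one_ne_zero,
    integrable_withDensity_iff_integrable_smul' (measurable_gaussianPDF _ _)
      (ae_of_all _ fun _ => gaussianPDF_lt_top)] at hf
  simpa only [toReal_gaussianPDF, smul_eq_mul] using hf

lemma hasDerivAt_gaussianPDFReal (x : ℝ) :
    HasDerivAt (gaussianPDFReal 0 1) (-x * gaussianPDFReal 0 1 x) x := by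
  have hexponent : HasDerivAt (fun x : ℝ => -(x - 0) ^ 2 / (2 * ((1 : ℝ≥0) : ℝ))) (-x) x := by
    refine (((((hasDerivAt_id x).sub_const 0).fun_pow 2).fun_neg).div_const
      (2 * ((1 : ℝ≥0) : ℝ))).congr_deriv ?_
    simp only [Nat.add_one_sub_one, id_eq, NNReal.coe_one]
    ring
  refine (hexponent.exp.const_mul (√(2 * Real.pi * ((1 : ℝ≥0) : ℝ)))⁻¹).congr_deriv ?_
  rw [gaussianPDFReal]
  ring

lemma integral_mul_gaussianReal_eq_integral_deriv {u u' : ℝ → ℝ} (hu : ∀ x, HasDerivAt u (u' x) x)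
    (hint : Integrable u (gaussianReal 0 1)) (hint' : Integrable u' (gaussianReal 0 1))
    (hmul : Integrable (fun x => x * u x) (gaussianReal 0 1)) :
    ∫ x, x * u x ∂gaussianReal 0 1 = ∫ x, u' x ∂gaussianReal 0 1 := by
  have hparts := integral_mul_deriv_eq_deriv_mul_of_integrable
    (fun x _ => hasDerivAt_gaussianPDFReal x) (fun x _ => hu x)
    (integrable_gaussianPDFReal_mul hint')
    ((integrable_gaussianPDFReal_mul hmul).neg.congr (ae_of_all _ fun x => by
      simp only [Pi.neg_apply, Pi.mul_apply]; ring)) (integrable_gaussianPDFReal_mul hint)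
  simp only [integral_gaussianReal_eq_integral_smul one_ne_zero, smul_eq_mul]
  rw [hparts, ← integral_neg]
  congr 1 with x
  ring

lemma integral_coord_mul_stdNormal {n : ℕ} [NeZero n] {d : Fin (n + 1)}
    {F F' : (Fin (n + 1) → ℝ) → ℝ}
    (hF : ∀ g, g ≠ 0 → HasDerivAt (fun t => F (Function.update g d t)) (F' g) (g d))
    (hint : Integrable F (stdNormal (n + 1))) (hint' : Integrable F' (stdNormal (n + 1)))
    (hmul : Integrable (fun g => g d * F g) (stdNormal (n + 1))) :
    ∫ g, g d * F g ∂stdNormal (n + 1) = ∫ g, F' g ∂stdNormal (n + 1) := by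
  rw [integral_stdNormal_succ (d := d) hmul, integral_stdNormal_succ (d := d) hint']
  refine integral_congr_ae ?_
  filter_upwards [ae_integrable_insertNth (d := d) hint, ae_integrable_insertNth (d := d) hint',
    ae_integrable_insertNth (d := d) hmul, ae_ne_zero_stdNormal] with y hy hy' hymul hyne
  simp only [Fin.insertNth_apply_same] at hymul ⊢
  refine integral_mul_gaussianReal_eq_integral_deriv (fun x => ?_) hy hy' hymul
  have hne : d.insertNth (α := fun _ => ℝ) x y ≠ 0 := fun h => hyne <| funext fun j => by
    simpa using congrFun h (d.succAbove j)
  simpa [Fin.update_insertNth] using hF _ hne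

end Stein

section Energy

variable {n : ℕ}

/-- The squared Euclidean norm, as a plain sum since `Fin n → ℝ` carries the sup norm. -/
def normSq (y : Fin n → ℝ) : ℝ := ∑ j, y j ^ 2

/-- The share `g_d² / ‖g‖²` of the `d`-th spin in the squared norm; it is the squared overlap of
the point `g / ‖g‖` of the sphere with the `d`-th eigenvector. -/
noncomputable def overlap (d : Fin n) (g : Fin n → ℝ) : ℝ := g d ^ 2 / normSq g

@[fun_prop]
lemma measurable_normSq : Measurable (normSq : (Fin n → ℝ) → ℝ) := by
  unfold normSq
  fun_prop

lemma normSq_nonneg (y : Fin n → ℝ) : 0 ≤ normSq y :=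
  Finset.sum_nonneg fun _ _ => sq_nonneg _

lemma sq_le_normSq (d : Fin n) (g : Fin n → ℝ) : g d ^ 2 ≤ normSq g :=
  Finset.single_le_sum (f := fun j => g j ^ 2) (fun _ _ => sq_nonneg _) (Finset.mem_univ d)

lemma normSq_pos {y : Fin n → ℝ} (hy : y ≠ 0) : 0 < normSq y := by
  obtain ⟨j, hj⟩ := Function.ne_iff.1 hy
  exact (pow_pos (abs_pos.2 hj) 2).trans_le ((sq_abs _).trans_le (sq_le_normSq j y))

lemma normSq_eq_sq_add (d : Fin (n + 1)) (g : Fin (n + 1) → ℝ) :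
    normSq g = g d ^ 2 + normSq (d.removeNth g) :=
  Fin.sum_univ_succAbove _ d

lemma overlap_nonneg (d : Fin n) (g : Fin n → ℝ) : 0 ≤ overlap d g :=
  div_nonneg (sq_nonneg _) (normSq_nonneg g)

lemma overlap_le_one (d : Fin n) (g : Fin n → ℝ) : overlap d g ≤ 1 :=
  div_le_one_of_le₀ (sq_le_normSq d g) (normSq_nonneg g)

lemma overlap_mul_normSq (d : Fin n) (g : Fin n → ℝ) : overlap d g * normSq g = g d ^ 2 :=
  div_mul_cancel_of_imp fun h => le_antisymm (h ▸ sq_le_normSq d g) (sq_nonneg _)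

@[fun_prop]
lemma measurable_overlap (d : Fin n) : Measurable (overlap d) := by
  unfold overlap
  fun_prop

variable {γ : Fin n → ℝ}

lemma hN_eq_sum (γ g : Fin n → ℝ) : hN γ g = ∑ i, γ i * overlap i g := by
  rcases n.eq_zero_or_pos with rfl | hn
  · simp [hN, HN]
  · exact mul_div_cancel_left₀ _ (Nat.cast_ne_zero.2 hn.ne')

lemma hN_eq_div (γ g : Fin n → ℝ) : hN γ g = (∑ i, γ i * g i ^ 2) / normSq g := by
  simp only [hN_eq_sum, overlap, ← mul_div_assoc, Finset.sum_div]

lemma HN_eq_mul_hN (γ g : Fin n → ℝ) : HN γ g = n * hN γ g := by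
  rw [hN_eq_sum, HN]
  rfl

@[fun_prop]
lemma measurable_hN (γ : Fin n → ℝ) : Measurable (hN γ) := by
  simp only [funext (hN_eq_sum γ)]
  fun_prop

lemma abs_hN_le {B : ℝ} (hB : 0 ≤ B) (hγ : ∀ i, |γ i| ≤ B) (g : Fin n → ℝ) : |hN γ g| ≤ B := by
  rw [hN_eq_div, abs_div, abs_of_nonneg (normSq_nonneg g)]
  refine div_le_of_le_mul₀ (normSq_nonneg g) hB ?_
  rw [normSq, Finset.mul_sum]
  refine (Finset.abs_sum_le_sum_abs _ _).trans (Finset.sum_le_sum fun i _ => ?_)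
  rw [abs_mul, abs_of_nonneg (sq_nonneg (g i))]
  exact mul_le_mul_of_nonneg_right (hγ i) (sq_nonneg _)

lemma hasDerivAt_sum_mul_sq_update (a g : Fin n → ℝ) (d : Fin n) :
    HasDerivAt (fun t => ∑ i, a i * Function.update g d t i ^ 2) (2 * a d * g d) (g d) := by
  have hcoord : ∀ i, HasDerivAt (fun t => Function.update g d t i)
      ((Pi.single d 1 : Fin n → ℝ) i) (g d) :=
    hasDerivAt_pi.1 (hasDerivAt_update g d (g d))
  refine (HasDerivAt.fun_sum fun i _ => ((hcoord i).fun_pow 2).const_mul (a i)).congr_deriv ?_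
  simp only [Function.update_eq_self, Pi.single_apply, mul_ite, mul_one, mul_zero,
    Finset.sum_ite_eq', Finset.mem_univ, if_true]
  ring

lemma hasDerivAt_normSq_update (g : Fin n → ℝ) (d : Fin n) :
    HasDerivAt (fun t => normSq (Function.update g d t)) (2 * g d) (g d) := by
  simpa [normSq] using hasDerivAt_sum_mul_sq_update 1 g d

lemma hasDerivAt_hN_update (γ : Fin n → ℝ) {g : Fin n → ℝ} (hg : g ≠ 0) (d : Fin n) :
    HasDerivAt (fun t => hN γ (Function.update g d t))
      (2 * g d / normSq g * (γ d - hN γ g)) (g d) := by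
  have hpos : normSq g ≠ 0 := (normSq_pos hg).ne'
  simp only [hN_eq_div]
  refine ((hasDerivAt_sum_mul_sq_update γ g d).fun_div (hasDerivAt_normSq_update g d)
    (by rwa [Function.update_eq_self])).congr_deriv ?_
  simp only [Function.update_eq_self]
  field_simp

end Energy

section Removal

variable {n : ℕ}

lemma hN_eq_sub_overlap_mul (γ : Fin (n + 1) → ℝ) (d : Fin (n + 1)) (g : Fin (n + 1) → ℝ) :
    hN γ g = hN (d.removeNth γ) (d.removeNth g) -
      overlap d g * (hN (d.removeNth γ) (d.removeNth g) - γ d) := by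
  rcases eq_or_ne (d.removeNth g) 0 with hbar | hbar
  · have hzero : hN (d.removeNth γ) 0 = 0 := by simp [hN_eq_div]
    have hg : normSq g = g d ^ 2 := by rw [normSq_eq_sq_add d, hbar]; simp [normSq]
    have hnum : ∑ i, γ i * g i ^ 2 = γ d * g d ^ 2 := by
      rw [Fin.sum_univ_succAbove _ d, add_eq_left]
      exact Finset.sum_eq_zero fun j _ => by simp [show g (d.succAbove j) = 0 from congrFun hbar j]
    rw [hbar, hzero, hN_eq_div, hnum, overlap, hg]
    ring
  · have hpos : 0 < normSq (d.removeNth g) := normSq_pos hbar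
    have hnum : ∑ i, γ i * g i ^ 2 =
        γ d * g d ^ 2 + ∑ j, d.removeNth γ j * d.removeNth g j ^ 2 := Fin.sum_univ_succAbove _ d
    rw [hN_eq_div, hN_eq_div, overlap, hnum, normSq_eq_sq_add d g]
    have : g d ^ 2 + normSq (d.removeNth g) ≠ 0 := by positivity
    field_simp
    ring

lemma Hd_eq_sub (γ : Fin (n + 1) → ℝ) (v : ℝ) (d : Fin (n + 1)) (g : Fin (n + 1) → ℝ) :
    Hd γ v d g = (n + 1) * hN (d.removeNth γ) (d.removeNth g) - (v - γ d) * g d ^ 2 := by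
  have herase : ∀ F : Fin (n + 1) → ℝ, ∑ i ∈ Finset.univ.erase d, F i = ∑ j, F (d.succAbove j) :=
    fun F => by
      rw [← add_right_inj (F d), Finset.add_sum_erase _ _ (Finset.mem_univ d),
        Fin.sum_univ_succAbove F d]
  rw [Hd, herase, herase, hN_eq_sum, Nat.cast_succ]
  rfl

lemma abs_hN_removeNth_sub_le {B : ℝ} {γ : Fin (n + 1) → ℝ} (hγ : ∀ i, |γ i| ≤ B)
    (d : Fin (n + 1)) (y : Fin n → ℝ) : |hN (d.removeNth γ) y - γ d| ≤ 2 * B := by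
  have hbar : |hN (d.removeNth γ) y| ≤ B :=
    abs_hN_le ((abs_nonneg _).trans (hγ d)) (fun j => hγ (d.succAbove j)) y
  exact (abs_sub _ _).trans ((add_le_add hbar (hγ d)).trans_eq (two_mul B).symm)

end Removal

section Integrability

variable {n : ℕ}

lemma integrable_exp_normSq_div_four :
    Integrable (fun g => Real.exp (normSq g / 4)) (stdNormal n) := by
  have hprod : ∀ g : Fin n → ℝ,
      Real.exp (normSq g / 4) = ∏ i, Real.exp (-(-(1 / 4) * g i ^ 2)) := fun g => by
    rw [normSq, Finset.sum_div, Real.exp_sum]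
    congr! 2
    ring
  simp only [hprod]
  exact Integrable.fintype_prod fun _ => integrable_exp_neg_sq_gaussianReal (by norm_num)

lemma integrable_of_abs_le_pow {u : (Fin n → ℝ) → ℝ} (hu : Measurable u) {C : ℝ} {m : ℕ}
    (hle : ∀ g, |u g| ≤ C * (1 + normSq g) ^ m) : Integrable u (stdNormal n) := by
  have hdom : Integrable
      (fun g => |C| * (4 ^ m * m.factorial) * Real.exp (1 / 4) * Real.exp (normSq g / 4))
      (stdNormal n) := integrable_exp_normSq_div_four.const_mul _
  refine hdom.mono' hu.aestronglyMeasurable (ae_of_all _ fun g => (hle g).trans ?_)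
  have hR := normSq_nonneg g
  have hexp : (1 + normSq g) ^ m ≤ 4 ^ m * m.factorial * Real.exp ((1 + normSq g) / 4) := by
    have h := Real.pow_div_factorial_le_exp ((1 + normSq g) / 4) (by positivity) m
    rw [div_pow, div_div, div_le_iff₀ (by positivity)] at h
    rwa [mul_comm]
  calc C * (1 + normSq g) ^ m
      ≤ |C| * (4 ^ m * m.factorial * Real.exp ((1 + normSq g) / 4)) :=
        mul_le_mul (le_abs_self C) hexp (by positivity) (abs_nonneg C)
    _ = _ := by rw [add_div, Real.exp_add]; ring

lemma integrable_normSq_pow (k : ℕ) : Integrable (fun g => normSq g ^ k) (stdNormal n) := by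
  refine integrable_of_abs_le_pow (C := 1) (m := k) (by fun_prop) fun g => ?_
  have hR := normSq_nonneg g
  rw [abs_of_nonneg (by positivity), one_mul]
  gcongr
  linarith

lemma integrable_sq_mul_normSq_pow (d : Fin n) (k : ℕ) :
    Integrable (fun g => g d ^ 2 * normSq g ^ k) (stdNormal n) := by
  refine (integrable_normSq_pow (k + 1)).mono' (by fun_prop) (ae_of_all _ fun g => ?_)
  have hR := normSq_nonneg g
  rw [Real.norm_of_nonneg (by positivity), pow_succ' (normSq g) k]
  exact mul_le_mul_of_nonneg_right (sq_le_normSq d g) (by positivity)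

lemma integrable_coord_mul_normSq_pow (d : Fin n) (k : ℕ) :
    Integrable (fun g => g d * normSq g ^ k) (stdNormal n) := by
  refine ((integrable_normSq_pow k).add (integrable_sq_mul_normSq_pow d k)).mono' (by fun_prop)
    (ae_of_all _ fun g => ?_)
  have hR := normSq_nonneg g
  have hcoord : |g d| ≤ 1 + g d ^ 2 := by
    rw [← sq_abs]
    nlinarith [sq_nonneg (|g d| - 1)]
  simp only [Pi.add_apply]
  rw [Real.norm_eq_abs, abs_mul, abs_of_nonneg (pow_nonneg hR k)]
  exact (mul_le_mul_of_nonneg_right hcoord (by positivity)).trans_eq (by ring)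

lemma integrable_normSq_div_sub_one_sq (a : ℝ) :
    Integrable (fun g => (normSq g / a - 1) ^ 2) (stdNormal n) := by
  have hsq : MemLp normSq 2 (stdNormal n) :=
    (memLp_two_iff_integrable_sq (by fun_prop)).2 (integrable_normSq_pow 2)
  simp only [div_eq_mul_inv]
  exact ((hsq.mul_const _).sub (memLp_const 1)).integrable_sq

end Integrability

section Gibbs

variable {n : ℕ} {κ : ℝ} {γ : Fin n → ℝ}

lemma abs_hN_le_sum (γ g : Fin n → ℝ) : |hN γ g| ≤ ∑ i, |γ i| :=
  abs_hN_le (Finset.sum_nonneg fun _ _ => abs_nonneg _) (fun i =>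
    Finset.single_le_sum (f := fun i => |γ i|) (fun _ _ => abs_nonneg _) (Finset.mem_univ i)) g

lemma integrable_mul_exp_hN {u : (Fin n → ℝ) → ℝ} (hu : Integrable u (stdNormal n)) :
    Integrable (fun g => u g * Real.exp (κ * hN γ g)) (stdNormal n) := by
  refine hu.mul_bdd (c := Real.exp (|κ| * ∑ i, |γ i|)) (by fun_prop) (ae_of_all _ fun g => ?_)
  rw [Real.norm_eq_abs, Real.abs_exp, Real.exp_le_exp]
  calc κ * hN γ g ≤ |κ| * |hN γ g| := (le_abs_self _).trans_eq (abs_mul _ _)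
    _ ≤ _ := mul_le_mul_of_nonneg_left (abs_hN_le_sum γ g) (abs_nonneg κ)

lemma integrable_exp_hN (κ : ℝ) (γ : Fin n → ℝ) :
    Integrable (fun g => Real.exp (κ * hN γ g)) (stdNormal n) := by
  simpa only [one_mul] using integrable_mul_exp_hN (integrable_const (1 : ℝ))

lemma integral_exp_hN_pos (κ : ℝ) (γ : Fin n → ℝ) :
    0 < ∫ g, Real.exp (κ * hN γ g) ∂stdNormal n :=
  integral_exp_pos (integrable_exp_hN κ γ)

/-- The Gibbs measure on `ℝⁿ` with weight `exp (κ h_n)`. It is the Gibbs measure of `H_n` at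
temperature `θ` when `κ = θ n`; keeping `κ` free decouples the temperature from the dimension. -/
noncomputable def gibbs (γ : Fin n → ℝ) (κ : ℝ) : Measure (Fin n → ℝ) :=
  (stdNormal n).tilted fun g => κ * hN γ g

instance isProbabilityMeasure_gibbs : IsProbabilityMeasure (gibbs γ κ) :=
  isProbabilityMeasure_tilted (integrable_exp_hN κ γ)

lemma integral_mul_exp_hN (u : (Fin n → ℝ) → ℝ) :
    ∫ g, u g * Real.exp (κ * hN γ g) ∂stdNormal n =
      (∫ g, Real.exp (κ * hN γ g) ∂stdNormal n) * ∫ g, u g ∂gibbs γ κ := by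
  rw [gibbs, integral_tilted, ← integral_const_mul]
  congr 1 with g
  rw [smul_eq_mul, ← mul_assoc, mul_div_cancel₀ _ (integral_exp_hN_pos κ γ).ne', mul_comm]

lemma gibbsMean_HN (θ : ℝ) (f : (Fin n → ℝ) → ℝ) :
    gibbsMean θ (HN γ) f = ∫ g, f g ∂gibbs γ (θ * n) := by
  simp only [gibbsMean, HN_eq_mul_hN, ← mul_assoc]
  rw [integral_mul_exp_hN, inv_mul_cancel_left₀ (integral_exp_hN_pos _ γ).ne']

lemma integrable_gibbs {u : (Fin n → ℝ) → ℝ} (hu : Integrable u (stdNormal n)) :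
    Integrable u (gibbs γ κ) := by
  refine (integrable_tilted_iff (integrable_exp_hN κ γ) _).2 ?_
  simpa only [smul_eq_mul, mul_comm] using integrable_mul_exp_hN hu

end Gibbs

section SchwingerDyson

variable {n : ℕ} {κ : ℝ} {γ : Fin n → ℝ}

lemma hasDerivAt_coord_mul_normSq_pow_mul_exp_hN (k : ℕ) (d : Fin n)
    {g : Fin n → ℝ} (hg : g ≠ 0) :
    HasDerivAt (fun t => Function.update g d t d * normSq (Function.update g d t) ^ k *
        Real.exp (κ * hN γ (Function.update g d t)))
      ((normSq g ^ k + 2 * k * (g d ^ 2 * normSq g ^ (k - 1)) +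
        2 * κ * (normSq g ^ k * (overlap d g * (γ d - hN γ g)))) * Real.exp (κ * hN γ g))
      (g d) := by
  have hexp := ((hasDerivAt_hN_update γ hg d).const_mul κ).exp
  have hpow := (hasDerivAt_normSq_update g d).fun_pow k
  simp only [Function.update_self]
  refine (((hasDerivAt_id (g d)).fun_mul hpow).fun_mul hexp).congr_deriv ?_
  simp only [Function.update_eq_self, id, overlap]
  ring

lemma abs_overlap_mul_sub_le (d : Fin n) (g : Fin n → ℝ) :
    |overlap d g * (γ d - hN γ g)| ≤ |γ d| + ∑ i, |γ i| := by
  rw [abs_mul, abs_of_nonneg (overlap_nonneg d g)]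
  exact (mul_le_of_le_one_left (abs_nonneg _) (overlap_le_one d g)).trans
    ((abs_sub _ _).trans (by gcongr; exact abs_hN_le_sum γ g))

lemma integrable_normSq_pow_mul_overlap (k : ℕ) (d : Fin n) :
    Integrable (fun g => normSq g ^ k * (overlap d g * (γ d - hN γ g))) (stdNormal n) :=
  (integrable_normSq_pow k).mul_bdd (by fun_prop) (ae_of_all _ fun g => abs_overlap_mul_sub_le d g)

lemma sum_overlap_mul_sub (γ g : Fin n → ℝ) : ∑ d, overlap d g * (γ d - hN γ g) = 0 := by
  rcases eq_or_ne g 0 with rfl | hg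
  · simp [overlap]
  · have hone : ∑ d, overlap d g = 1 := by
      simp only [overlap, ← Finset.sum_div]
      exact div_self (normSq_pos hg).ne'
    simp only [mul_sub, Finset.sum_sub_distrib, ← Finset.sum_mul, hone]
    rw [hN_eq_sum γ g]
    simp [mul_comm]

end SchwingerDyson

section Moments

variable {n : ℕ} [NeZero n] {κ : ℝ} {γ : Fin (n + 1) → ℝ}

lemma integral_sq_mul_normSq_pow_gibbs (k : ℕ) (d : Fin (n + 1)) :
    ∫ g, g d ^ 2 * normSq g ^ k ∂gibbs γ κ =
      ∫ g, (normSq g ^ k + 2 * k * (g d ^ 2 * normSq g ^ (k - 1)) +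
        2 * κ * (normSq g ^ k * (overlap d g * (γ d - hN γ g)))) ∂gibbs γ κ := by
  refine mul_left_cancel₀ (integral_exp_hN_pos κ γ).ne' ?_
  have hmul := integrable_mul_exp_hN (κ := κ) (γ := γ) (integrable_sq_mul_normSq_pow d k)
  simp only [← integral_mul_exp_hN]
  rw [← integral_coord_mul_stdNormal
    (fun g hg => hasDerivAt_coord_mul_normSq_pow_mul_exp_hN k d hg)
    (integrable_mul_exp_hN (integrable_coord_mul_normSq_pow d k))
    (integrable_mul_exp_hN (((integrable_normSq_pow k).add
      ((integrable_sq_mul_normSq_pow d (k - 1)).const_mul _)).add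
      ((integrable_normSq_pow_mul_overlap k d).const_mul _)))
    (hmul.congr (ae_of_all _ fun g => by ring))]
  congr 1 with g
  ring

lemma integral_normSq_pow_succ_gibbs (k : ℕ) :
    ∫ g, normSq g ^ (k + 1) ∂gibbs γ κ = ((n : ℝ) + 1 + 2 * k) * ∫ g, normSq g ^ k ∂gibbs γ κ := by
  have hsum : ∀ g : Fin (n + 1) → ℝ, ∑ d, (normSq g ^ k + 2 * k * (g d ^ 2 * normSq g ^ (k - 1)) +
      2 * κ * (normSq g ^ k * (overlap d g * (γ d - hN γ g)))) =
      ((n : ℝ) + 1 + 2 * k) * normSq g ^ k := fun g => by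
    simp only [Finset.sum_add_distrib, ← Finset.mul_sum, ← Finset.sum_mul, sum_overlap_mul_sub γ g]
    rw [Finset.sum_const, Finset.card_univ, Fintype.card_fin, nsmul_eq_mul, Nat.cast_succ,
      ← normSq]
    rcases k with _ | k
    · simp
    · rw [Nat.add_sub_cancel]
      ring
  calc ∫ g, normSq g ^ (k + 1) ∂gibbs γ κ
      = ∫ g, ∑ d, g d ^ 2 * normSq g ^ k ∂gibbs γ κ := by
        simp only [← Finset.sum_mul, pow_succ', normSq]
    _ = ∑ d, ∫ g, g d ^ 2 * normSq g ^ k ∂gibbs γ κ :=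
        integral_finsetSum _ fun d _ => integrable_gibbs (integrable_sq_mul_normSq_pow d k)
    _ = ∫ g, ((n : ℝ) + 1 + 2 * k) * normSq g ^ k ∂gibbs γ κ := by
        simp only [integral_sq_mul_normSq_pow_gibbs, ← hsum]
        refine (integral_finsetSum _ fun d _ => integrable_gibbs ?_).symm
        exact ((integrable_normSq_pow k).add
          ((integrable_sq_mul_normSq_pow d (k - 1)).const_mul _)).add
          ((integrable_normSq_pow_mul_overlap k d).const_mul _)
    _ = _ := integral_const_mul _ _

lemma integral_normSq_div_sub_one_sq_gibbs :
    ∫ g, (normSq g / (n + 1) - 1) ^ 2 ∂gibbs γ κ = 2 / ((n : ℝ) + 1) := by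
  have hone : ∫ g, normSq g ^ 1 ∂gibbs γ κ = (n : ℝ) + 1 := by
    simpa using integral_normSq_pow_succ_gibbs (γ := γ) (κ := κ) 0
  have htwo : ∫ g, normSq g ^ 2 ∂gibbs γ κ = ((n : ℝ) + 3) * (n + 1) := by
    rw [integral_normSq_pow_succ_gibbs 1, hone, Nat.cast_one]
    ring
  have hpos : (n : ℝ) + 1 ≠ 0 := by positivity
  have hint : ∀ k, Integrable (fun g => normSq g ^ k) (gibbs γ κ) := fun k =>
    integrable_gibbs (integrable_normSq_pow k)
  have hexpand : ∀ g : Fin (n + 1) → ℝ, (normSq g / (n + 1) - 1) ^ 2 =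
      (((n : ℝ) + 1) ^ 2)⁻¹ * normSq g ^ 2 - 2 / ((n : ℝ) + 1) * normSq g ^ 1 + 1 := fun g => by
    field_simp
    ring
  simp only [hexpand]
  rw [integral_add (((hint 2).const_mul _).sub' ((hint 1).const_mul _)) (integrable_const _),
    integral_sub ((hint 2).const_mul _) ((hint 1).const_mul _), integral_const_mul,
    integral_const_mul, hone, htwo, integral_const, probReal_univ]
  field_simp
  ring

end Moments

section Fluctuation

lemma integral_abs_le_sqrt_integral_sq {Ω : Type*} [MeasurableSpace Ω] {μ : Measure Ω}
    [IsProbabilityMeasure μ] {X : Ω → ℝ} (hX : MemLp X 2 μ) :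
    ∫ ω, |X ω| ∂μ ≤ √(∫ ω, X ω ^ 2 ∂μ) := by
  have hvar := variance_nonneg |X| μ
  rw [variance_eq_sub hX.abs] at hvar
  refine Real.le_sqrt_of_sq_le ?_
  simpa only [Pi.pow_apply, Pi.abs_apply, sq_abs, sub_nonneg] using hvar

variable {n : ℕ} {B c v θ : ℝ} {γ : Fin (n + 1) → ℝ}

/-- The random error scale of the comparison. For `y` in `ℝⁿ`, the spins other than the removed
one, it measures how far their energy is from `v` and their squared norm from `n + 1`; the last
term, the size of a single overlap, keeps it positive. -/
noncomputable def fluctuation (γ : Fin n → ℝ) (v : ℝ) (y : Fin n → ℝ) : ℝ :=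
  |hN γ y - v| + |normSq y / (n + 1) - 1| + 1 / (n + 1)

lemma one_div_le_fluctuation (γ : Fin n → ℝ) (v : ℝ) (y : Fin n → ℝ) :
    1 / ((n : ℝ) + 1) ≤ fluctuation γ v y :=
  le_add_of_nonneg_left (by positivity)

lemma fluctuation_pos (γ : Fin n → ℝ) (v : ℝ) (y : Fin n → ℝ) : 0 < fluctuation γ v y :=
  (one_div_pos.2 n.cast_add_one_pos).trans_le (one_div_le_fluctuation γ v y)

lemma abs_hN_sub_le_fluctuation (γ : Fin n → ℝ) (v : ℝ) (y : Fin n → ℝ) :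
    |hN γ y - v| ≤ fluctuation γ v y :=
  (le_add_of_nonneg_right (abs_nonneg _)).trans (le_add_of_nonneg_right (by positivity))

lemma abs_normSq_div_sub_one_le_fluctuation (γ : Fin n → ℝ) (v : ℝ) (y : Fin n → ℝ) :
    |normSq y / (n + 1) - 1| ≤ fluctuation γ v y :=
  (le_add_of_nonneg_left (abs_nonneg _)).trans (le_add_of_nonneg_right (by positivity))

lemma abs_overlap_sub_le (d : Fin (n + 1)) (g : Fin (n + 1) → ℝ) :
    |overlap d g - g d ^ 2 / (n + 1)| ≤ |normSq g / (n + 1) - 1| := by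
  have hfactor : overlap d g - g d ^ 2 / (n + 1) = overlap d g * (1 - normSq g / (n + 1)) := by
    rw [← overlap_mul_normSq d g]
    ring
  rw [hfactor, abs_mul, abs_of_nonneg (overlap_nonneg d g), abs_sub_comm]
  exact mul_le_of_le_one_left (abs_nonneg _) (overlap_le_one d g)

lemma fluctuation_removeNth_le (hγ : ∀ i, |γ i| ≤ B) (d : Fin (n + 1))
    (g : Fin (n + 1) → ℝ) :
    fluctuation (d.removeNth γ) v (d.removeNth g) ≤ |hN γ g - v| + (2 * B + 1) * overlap d g +
      2 * |normSq g / (n + 1) - 1| + 1 / (n + 1) := by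
  set hbar := hN (d.removeNth γ) (d.removeNth g)
  have henergy : |hbar - v| ≤ |hN γ g - v| + 2 * B * overlap d g := by
    have hsub : hbar - v = hN γ g - v + (hbar - γ d) * overlap d g := by
      rw [hN_eq_sub_overlap_mul γ d g]
      ring
    rw [hsub]
    refine (abs_add_le _ _).trans (add_le_add_right ?_ _)
    rw [abs_mul, abs_of_nonneg (overlap_nonneg d g)]
    exact mul_le_mul_of_nonneg_right (abs_hN_removeNth_sub_le hγ d _) (overlap_nonneg d g)
  have hradius : |normSq (d.removeNth g) / (n + 1) - 1| ≤
      2 * |normSq g / (n + 1) - 1| + overlap d g := by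
    have hsub : normSq (d.removeNth g) / (n + 1) - 1 =
        normSq g / (n + 1) - 1 + (overlap d g - g d ^ 2 / (n + 1)) - overlap d g := by
      rw [normSq_eq_sq_add d g]
      ring
    rw [hsub]
    refine (abs_sub _ _).trans ?_
    rw [abs_of_nonneg (overlap_nonneg d g), two_mul]
    gcongr
    exact (abs_add_le _ _).trans (add_le_add_right (abs_overlap_sub_le d g) _)
  unfold fluctuation
  linarith

lemma integrable_hN_sub_gibbs (κ v : ℝ) : Integrable (fun g => hN γ g - v) (gibbs γ κ) :=
  (Integrable.of_bound (by fun_prop) _ (ae_of_all _ fun g => abs_hN_le_sum γ g)).sub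
    (integrable_const v)

lemma integrable_overlap_gibbs (κ : ℝ) (d : Fin (n + 1)) :
    Integrable (overlap d) (gibbs γ κ) :=
  Integrable.of_bound (by fun_prop) 1 (ae_of_all _ fun g => by
    rw [Real.norm_of_nonneg (overlap_nonneg d g)]
    exact overlap_le_one d g)

lemma memLp_normSq_div_sub_one_gibbs (κ : ℝ) :
    MemLp (fun g => normSq g / (n + 1) - 1) 2 (gibbs γ κ) :=
  (memLp_two_iff_integrable_sq (by fun_prop)).2
    (integrable_gibbs (integrable_normSq_div_sub_one_sq _))

lemma integrable_overlap_mul_sub_gibbs (κ : ℝ) (d : Fin (n + 1)) :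
    Integrable (fun g => overlap d g * (γ d - hN γ g)) (gibbs γ κ) :=
  Integrable.of_bound (by fun_prop) _ (ae_of_all _ fun g => abs_overlap_mul_sub_le d g)

lemma integral_sq_gibbs [NeZero n] (κ : ℝ) (d : Fin (n + 1)) :
    ∫ g, g d ^ 2 ∂gibbs γ κ =
      (1 : ℝ) + 2 * κ * ∫ g, overlap d g * (γ d - hN γ g) ∂gibbs γ κ := by
  have h := integral_sq_mul_normSq_pow_gibbs (γ := γ) (κ := κ) 0 d
  simp only [pow_zero, mul_one, CharP.cast_eq_zero, mul_zero, zero_mul, add_zero, one_mul] at h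
  rw [h, integral_add (integrable_const _) ((integrable_overlap_mul_sub_gibbs κ d).const_mul _),
    integral_const_mul, integral_const, probReal_univ, one_smul]

lemma mul_overlap_le (d : Fin (n + 1)) (hc : c ≤ 1 + 2 * θ * (v - γ d))
    (g : Fin (n + 1) → ℝ) :
    c * overlap d g ≤ g d ^ 2 / (n + 1) - 2 * θ * (overlap d g * (γ d - hN γ g)) +
      |normSq g / (n + 1) - 1| + 2 * |θ| * |hN γ g - v| := by
  have hprec := mul_le_mul_of_nonneg_right hc (overlap_nonneg d g)
  have hradius := (abs_le.1 (abs_overlap_sub_le d g)).2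
  have hcorr : overlap d g * (2 * θ * (v - hN γ g)) ≤ 2 * |θ| * |hN γ g - v| := by
    refine (le_abs_self _).trans ?_
    rw [abs_mul, abs_of_nonneg (overlap_nonneg d g), abs_mul, abs_mul, abs_two, abs_sub_comm v]
    exact mul_le_of_le_one_left (by positivity) (overlap_le_one d g)
  linarith

-- By Schwinger–Dyson the first two terms on the right of `mul_overlap_le` have mean `1 / N`.
lemma mul_integral_overlap_gibbs_le [NeZero n] (d : Fin (n + 1))
    (hc : c ≤ 1 + 2 * θ * (v - γ d)) :
    c * ∫ g, overlap d g ∂gibbs γ (θ * (n + 1)) ≤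
      1 / (n + 1) + ∫ g, |normSq g / (n + 1) - 1| ∂gibbs γ (θ * (n + 1)) +
        2 * |θ| * ∫ g, |hN γ g - v| ∂gibbs γ (θ * (n + 1)) := by
  have hdyson := integral_sq_gibbs (γ := γ) (θ * (n + 1)) d
  set μ := gibbs γ (θ * (n + 1))
  have hsq : Integrable (fun g => g d ^ 2) μ :=
    integrable_gibbs (by simpa using integrable_sq_mul_normSq_pow d 0)
  have hgap : Integrable (fun g => overlap d g * (γ d - hN γ g)) μ :=
    integrable_overlap_mul_sub_gibbs _ d
  have hnorm : Integrable (fun g => |normSq g / (n + 1) - 1|) μ :=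
    ((memLp_normSq_div_sub_one_gibbs _).integrable one_le_two).abs
  have henergy : Integrable (fun g => |hN γ g - v|) μ := (integrable_hN_sub_gibbs _ v).abs
  rw [← integral_const_mul]
  have hdiff := (hsq.div_const ((n : ℝ) + 1)).sub' (hgap.const_mul (2 * θ))
  have hsum := hdiff.fun_add hnorm
  refine (integral_mono ((integrable_overlap_gibbs _ d).const_mul c)
    (hsum.fun_add (henergy.const_mul _)) (mul_overlap_le d hc)).trans_eq ?_
  rw [integral_add hsum (henergy.const_mul _), integral_add hdiff hnorm,
    integral_sub (hsq.div_const _) (hgap.const_mul _), integral_div, integral_const_mul,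
    integral_const_mul, hdyson]
  field_simp
  ring

lemma integral_abs_normSq_div_sub_one_gibbs_le [NeZero n] (κ : ℝ) :
    ∫ g, |normSq g / (n + 1) - 1| ∂gibbs γ κ ≤ 2 * (1 / √((n : ℝ) + 1)) := by
  refine (integral_abs_le_sqrt_integral_sq (memLp_normSq_div_sub_one_gibbs _)).trans ?_
  rw [integral_normSq_div_sub_one_sq_gibbs, Real.sqrt_div zero_le_two, div_eq_mul_one_div]
  gcongr
  exact Real.sqrt_le_self_iff.2 (.inr one_le_two)

lemma integral_fluctuation_removeNth_le_add (κ : ℝ) (hγ : ∀ i, |γ i| ≤ B)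
    (d : Fin (n + 1)) :
    ∫ g, fluctuation (d.removeNth γ) v (d.removeNth g) ∂gibbs γ κ ≤
      ∫ g, |hN γ g - v| ∂gibbs γ κ + (2 * B + 1) * ∫ g, overlap d g ∂gibbs γ κ +
        2 * ∫ g, |normSq g / (n + 1) - 1| ∂gibbs γ κ + 1 / (n + 1) := by
  have henergy := (integrable_hN_sub_gibbs (γ := γ) κ v).abs
  have hshare := (integrable_overlap_gibbs (γ := γ) κ d).const_mul (2 * B + 1)
  have hnorm :=
    ((memLp_normSq_div_sub_one_gibbs (γ := γ) κ).integrable one_le_two).abs.const_mul 2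
  have hsum := (henergy.fun_add hshare).fun_add hnorm
  refine (integral_mono_of_nonneg (ae_of_all _ fun g => (fluctuation_pos _ _ _).le)
    (hsum.fun_add (integrable_const _)) (ae_of_all _ fun g =>
      fluctuation_removeNth_le hγ d g)).trans_eq ?_
  rw [integral_add hsum (integrable_const _), integral_add (henergy.fun_add hshare) hnorm,
    integral_add henergy hshare, integral_const_mul, integral_const_mul, integral_const,
    probReal_univ, one_smul]

lemma integral_fluctuation_removeNth_le [NeZero n] (hγ : ∀ i, |γ i| ≤ B)
    (d : Fin (n + 1)) (hc0 : 0 < c) (hc : c ≤ 1 + 2 * θ * (v - γ d)) :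
    ∫ g, fluctuation (d.removeNth γ) v (d.removeNth g) ∂gibbs γ (θ * (n + 1)) ≤
      (5 + (2 * B + 1) * (3 + 2 * |θ|) / c) *
        (1 / √((n : ℝ) + 1) + √(∫ g, (hN γ g - v) ^ 2 ∂gibbs γ (θ * (n + 1)))) := by
  have hB : 0 ≤ B := (abs_nonneg _).trans (hγ d)
  have hoverlap := mul_integral_overlap_gibbs_le d hc
  set μ := gibbs γ (θ * (n + 1))
  set q := 1 / √((n : ℝ) + 1)
  set a := ∫ g, (hN γ g - v) ^ 2 ∂μ
  have hinv : 1 / ((n : ℝ) + 1) ≤ q :=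
    one_div_le_one_div_of_le (by positivity)
      (Real.sqrt_le_self_iff.2 (.inr (by simp)))
  have hE_energy : ∫ g, |hN γ g - v| ∂μ ≤ √a := integral_abs_le_sqrt_integral_sq <|
    MemLp.of_bound (by fun_prop) ((∑ i, |γ i|) + |v|) (ae_of_all _ fun g =>
      (abs_sub _ _).trans (add_le_add_left (abs_hN_le_sum γ g) _))
  have hE_norm : ∫ g, |normSq g / (n + 1) - 1| ∂μ ≤ 2 * q :=
    integral_abs_normSq_div_sub_one_gibbs_le _
  have hE_overlap : ∫ g, overlap d g ∂μ ≤ (3 + 2 * |θ|) / c * (q + √a) := by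
    rw [div_mul_eq_mul_div, le_div_iff₀' hc0]
    have hq : 0 ≤ q := by positivity
    nlinarith [Real.sqrt_nonneg a, abs_nonneg θ]
  have hmono := integral_fluctuation_removeNth_le_add (v := v) (θ * (n + 1)) hγ d
  have hbound := mul_le_mul_of_nonneg_left hE_overlap (by positivity : 0 ≤ 2 * B + 1)
  calc _ ≤ √a + (2 * B + 1) * ((3 + 2 * |θ|) / c * (q + √a)) + 2 * (2 * q) + q := by linarith
    _ ≤ 5 * (q + √a) + (2 * B + 1) * ((3 + 2 * |θ|) / c * (q + √a)) := by
      linarith [Real.sqrt_nonneg a]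
    _ = _ := by ring

end Fluctuation

section Kernel

variable {θ c v η h B N R Y x τ : ℝ}

lemma abs_exp_sub_exp_le {a b m : ℝ} (ha : a ≤ m) (hb : b ≤ m) :
    |Real.exp a - Real.exp b| ≤ |a - b| * Real.exp m := by
  rw [mul_comm]
  refine (convex_Iic m).norm_image_sub_le_of_norm_deriv_le (f := Real.exp)
    (fun x _ => Real.differentiableAt_exp) (fun x hx => ?_) hb ha
  rw [Real.deriv_exp, Real.norm_of_nonneg (Real.exp_pos x).le]
  exact Real.exp_le_exp.2 hx

lemma sq_mul_one_add_sq_le (hc : 0 < c) (hc1 : c ≤ 1) (x : ℝ) :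
    x ^ 2 * (1 + x ^ 2) ≤ (16 / c) ^ 2 * Real.exp (c / 8 * x ^ 2) := by
  have hlin : 1 + x ^ 2 ≤ 16 / c * Real.exp (c / 16 * x ^ 2) := by
    have hone : 1 ≤ 16 / c := by
      rw [le_div_iff₀ hc]
      linarith
    calc 1 + x ^ 2 ≤ 16 / c + x ^ 2 := add_le_add_left hone _
      _ = 16 / c * (c / 16 * x ^ 2 + 1) := by field_simp; ring
      _ ≤ _ := mul_le_mul_of_nonneg_left (Real.add_one_le_exp _) (by positivity)
  calc x ^ 2 * (1 + x ^ 2) ≤ (1 + x ^ 2) ^ 2 := by nlinarith [sq_nonneg x]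
    _ ≤ (16 / c * Real.exp (c / 16 * x ^ 2)) ^ 2 := by gcongr
    _ = _ := by
      rw [mul_pow, ← Real.exp_nat_mul]
      congr 2
      push_cast
      ring

lemma div_sq_add_mul_one_sub_le (hN : 0 < N) (hR : |R / N - 1| ≤ Y) (hY : Y < 1) :
    N / (x ^ 2 + R) * (1 - Y) ≤ 1 := by
  have hRN : (1 - Y) * N ≤ R := (le_div_iff₀ hN).1 (by linarith [(abs_le.1 hR).1])
  have hpos : 0 < (1 - Y) * N := mul_pos (sub_pos.2 hY) hN
  rw [div_mul_eq_mul_div, div_le_one (by linarith [sq_nonneg x])]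
  linarith [sq_nonneg x]

lemma div_sq_add_le_two (hN : 0 < N) (hR : |R / N - 1| ≤ Y) (hY : Y ≤ 1 / 2) :
    N / (x ^ 2 + R) ≤ 2 := by
  have h := div_sq_add_mul_one_sub_le (x := x) hN (hR.trans hY) (by norm_num)
  linarith

lemma abs_div_sq_add_sub_one_le (hN : 0 < N) (hR : |R / N - 1| ≤ Y) (hNY : 1 / N ≤ Y)
    (hY : Y ≤ 1 / 2) : |N / (x ^ 2 + R) - 1| ≤ 2 * Y * (1 + x ^ 2) := by
  have hRpos : 0 < R := by
    have := (abs_le.1 hR).1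
    exact (div_pos_iff_of_pos_right hN).1 (by linarith)
  have hfactor : N / (x ^ 2 + R) - 1 =
      -(N / (x ^ 2 + R) * (R / N - 1 + x ^ 2 * (1 / N))) := by
    field_simp
    ring
  have herror : |R / N - 1 + x ^ 2 * (1 / N)| ≤ Y * (1 + x ^ 2) := by
    rw [mul_one_add, mul_comm Y (x ^ 2)]
    refine (abs_add_le _ _).trans (add_le_add hR ?_)
    rw [abs_of_nonneg (by positivity)]
    exact mul_le_mul_of_nonneg_left hNY (sq_nonneg x)
  rw [hfactor, abs_neg, abs_mul, abs_of_nonneg (by positivity), mul_assoc]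
  exact mul_le_mul (div_sq_add_le_two hN hR hY) herror (abs_nonneg _) zero_le_two

lemma neg_mul_sub_mul_le (hc0 : 0 ≤ c) (hc1 : c ≤ 1) (hcη : c ≤ 1 + 2 * θ * (v - η))
    (hh : 8 * |θ| * |h - v| ≤ c) (hτ0 : 0 ≤ τ) (hτ : τ * (1 - c / 4) ≤ 1) :
    -(θ * (h - η) * τ) ≤ (1 - c / 2) / 2 := by
  have hθh : -(θ * (h - v)) ≤ c / 8 := by
    refine (neg_le_abs _).trans ?_
    rw [abs_mul]
    linarith
  have hgap : -(θ * (h - η)) ≤ (1 - 3 * c / 4) / 2 := by linarith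
  calc -(θ * (h - η) * τ) = -(θ * (h - η)) * τ := by ring
    _ ≤ (1 - 3 * c / 4) / 2 * τ := mul_le_mul_of_nonneg_right hgap hτ0
    _ ≤ (1 - c / 2) / 2 * (τ * (1 - c / 4)) := by nlinarith [mul_nonneg hτ0 (mul_nonneg hc0 hc0)]
    _ ≤ (1 - c / 2) / 2 := mul_le_of_le_one_right (by linarith) hτ

lemma abs_mul_sub_mul_sub_le (hh : |h - v| ≤ Y) (hη : |v - η| ≤ B)
    (hτ2 : |τ| ≤ 2) (hτ : |τ - 1| ≤ 2 * Y * (1 + x ^ 2)) :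
    |(h - η) * τ - (v - η)| ≤ 2 * (1 + B) * Y * (1 + x ^ 2) := by
  have hY : 0 ≤ Y := (abs_nonneg _).trans hh
  have hfirst : |(h - v) * τ| ≤ 2 * Y * (1 + x ^ 2) := by
    rw [abs_mul]
    calc |h - v| * |τ| ≤ Y * 2 := mul_le_mul hh hτ2 (abs_nonneg _) hY
      _ ≤ _ := by nlinarith [mul_nonneg hY (sq_nonneg x)]
  have hsecond : |(v - η) * (τ - 1)| ≤ B * (2 * Y * (1 + x ^ 2)) := by
    rw [abs_mul]
    exact mul_le_mul hη hτ (abs_nonneg _) ((abs_nonneg _).trans hη)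
  calc |(h - η) * τ - (v - η)| = |(h - v) * τ + (v - η) * (τ - 1)| := by ring_nf
    _ ≤ 2 * Y * (1 + x ^ 2) + B * (2 * Y * (1 + x ^ 2)) :=
      (abs_add_le _ _).trans (add_le_add hfirst hsecond)
    _ = _ := by ring

lemma abs_neg_mul_sq_sub_le (hh : |h - v| ≤ Y) (hη : |v - η| ≤ B)
    (hτ2 : |τ| ≤ 2) (hτ : |τ - 1| ≤ 2 * Y * (1 + x ^ 2)) :
    |-(θ * (h - η) * τ) * x ^ 2 - -(θ * (v - η)) * x ^ 2| ≤
      2 * |θ| * (1 + B) * Y * (x ^ 2 * (1 + x ^ 2)) := by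
  have hfactor : -(θ * (h - η) * τ) * x ^ 2 - -(θ * (v - η)) * x ^ 2 =
      -(θ * x ^ 2 * ((h - η) * τ - (v - η))) := by ring
  rw [hfactor, abs_neg, abs_mul, abs_mul, abs_sq]
  calc _ ≤ |θ| * x ^ 2 * (2 * (1 + B) * Y * (1 + x ^ 2)) :=
        mul_le_mul_of_nonneg_left (abs_mul_sub_mul_sub_le hh hη hτ2 hτ) (by positivity)
    _ = _ := by ring

lemma abs_exp_sub_exp_kernel_le (hc0 : 0 < c) (hc1 : c ≤ 1) (hcη : c ≤ 1 + 2 * θ * (v - η))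
    (hη : |v - η| ≤ B) (hN : 0 < N) (hh : |h - v| ≤ Y) (hR : |R / N - 1| ≤ Y)
    (hNY : 1 / N ≤ Y) (hY : 4 * (1 + 2 * |θ|) * Y ≤ c) :
    |Real.exp (-(θ * (h - η) * (N / (x ^ 2 + R))) * x ^ 2) -
        Real.exp (-(θ * (v - η)) * x ^ 2)| ≤
      2 * |θ| * (1 + B) * (16 / c) ^ 2 * Y * Real.exp ((1 - c / 4) / 2 * x ^ 2) := by
  have hY0 : 0 ≤ Y := (abs_nonneg _).trans hh
  have hB : 0 ≤ B := (abs_nonneg _).trans hη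
  have hθY : 0 ≤ |θ| * Y := by positivity
  have hRpos : 0 < R := by
    have := (abs_le.1 hR).1
    exact (div_pos_iff_of_pos_right hN).1 (by linarith)
  set τ := N / (x ^ 2 + R)
  have hτ0 : 0 ≤ τ := by positivity
  have hτY : τ * (1 - c / 4) ≤ 1 :=
    div_sq_add_mul_one_sub_le hN (hR.trans (by linarith)) (by linarith)
  have hτ2 : |τ| ≤ 2 := by
    rw [abs_of_nonneg hτ0]
    exact div_sq_add_le_two hN hR (by linarith)
  have hhc : 8 * |θ| * |h - v| ≤ c := by
    linarith [mul_le_mul_of_nonneg_left hh (abs_nonneg θ)]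
  have hexponent := neg_mul_sub_mul_le hc0.le hc1 hcη hhc hτ0 hτY
  have hcoupled : -(θ * (h - η) * τ) * x ^ 2 ≤ (1 - c / 2) / 2 * x ^ 2 :=
    mul_le_mul_of_nonneg_right hexponent (sq_nonneg x)
  have hdecoupled : -(θ * (v - η)) * x ^ 2 ≤ (1 - c / 2) / 2 * x ^ 2 :=
    mul_le_mul_of_nonneg_right (by linarith) (sq_nonneg x)
  have hdiff := abs_neg_mul_sq_sub_le (θ := θ) hh hη hτ2
    (abs_div_sq_add_sub_one_le hN hR hNY (by linarith))
  calc _ ≤ 2 * |θ| * (1 + B) * Y * ((16 / c) ^ 2 * Real.exp (c / 8 * x ^ 2)) *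
        Real.exp ((1 - c / 2) / 2 * x ^ 2) := by
        refine (abs_exp_sub_exp_le hcoupled hdecoupled).trans
          (mul_le_mul_of_nonneg_right (hdiff.trans ?_) (Real.exp_pos _).le)
        exact mul_le_mul_of_nonneg_left (sq_mul_one_add_sq_le hc0 hc1 x) (by positivity)
    _ = 2 * |θ| * (1 + B) * (16 / c) ^ 2 * Y *
        (Real.exp (c / 8 * x ^ 2) * Real.exp ((1 - c / 2) / 2 * x ^ 2)) := by ring
    _ = _ := by
        rw [← Real.exp_add]
        congr 2
        ring

end Kernel

section Weights

variable {n : ℕ} {B c v θ κ : ℝ} {γ : Fin (n + 1) → ℝ} {d : Fin (n + 1)}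

lemma exp_mul_hN_eq_mul (κ : ℝ) (γ : Fin (n + 1) → ℝ) (d : Fin (n + 1)) (g : Fin (n + 1) → ℝ) :
    Real.exp (κ * hN γ g) = Real.exp (κ * hN (d.removeNth γ) (d.removeNth g)) *
      Real.exp (-(κ * (overlap d g * (hN (d.removeNth γ) (d.removeNth g) - γ d)))) := by
  rw [hN_eq_sub_overlap_mul γ d g, ← Real.exp_add]
  congr 1
  ring

lemma exp_mul_Hd_eq_mul (θ v : ℝ) (γ : Fin (n + 1) → ℝ) (d : Fin (n + 1))
    (g : Fin (n + 1) → ℝ) :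
    Real.exp (θ * Hd γ v d g) = Real.exp (-(θ * (v - γ d) * g d ^ 2)) *
      Real.exp (θ * (n + 1) * hN (d.removeNth γ) (d.removeNth g)) := by
  rw [Hd_eq_sub, ← Real.exp_add]
  congr 1
  ring

lemma integrable_exp_mul_Hd (hpos : 0 < 1 + 2 * θ * (v - γ d)) :
    Integrable (fun g => Real.exp (θ * Hd γ v d g)) (stdNormal (n + 1)) := by
  simp only [exp_mul_Hd_eq_mul]
  exact integrable_mul_removeNth (ψ := fun y => Real.exp (θ * (n + 1) * hN (d.removeNth γ) y))
    (integrable_exp_neg_sq_gaussianReal (by linarith)) (integrable_exp_hN _ _)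

lemma abs_exp_mul_hN_sub_exp_mul_Hd_le_of_fluctuation_le (hc0 : 0 < c) (hc1 : c ≤ 1)
    (hc : c ≤ 1 + 2 * θ * (v - γ d)) (hB : |v - γ d| ≤ B) {g : Fin (n + 1) → ℝ}
    (hY : 4 * (1 + 2 * |θ|) * fluctuation (d.removeNth γ) v (d.removeNth g) ≤ c) :
    |Real.exp (θ * (n + 1) * hN γ g) - Real.exp (θ * Hd γ v d g)| ≤
      2 * |θ| * (1 + B) * (16 / c) ^ 2 * (Real.exp ((1 - c / 4) / 2 * g d ^ 2) *
        (fluctuation (d.removeNth γ) v (d.removeNth g) *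
          Real.exp (θ * (n + 1) * hN (d.removeNth γ) (d.removeNth g)))) := by
  have hkernel := abs_exp_sub_exp_kernel_le (x := g d) hc0 hc1 hc hB n.cast_add_one_pos
    (abs_hN_sub_le_fluctuation _ v (d.removeNth g))
    (abs_normSq_div_sub_one_le_fluctuation _ v _) (one_div_le_fluctuation _ _ _) hY
  rw [exp_mul_hN_eq_mul _ γ d, exp_mul_Hd_eq_mul]
  set M := Real.exp (θ * (n + 1) * hN (d.removeNth γ) (d.removeNth g))
  rw [mul_comm _ M, ← mul_sub, abs_mul, abs_of_pos (Real.exp_pos _), overlap, normSq_eq_sq_add d g]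
  refine (mul_le_mul_of_nonneg_left (Eq.trans_le ?_ hkernel) (Real.exp_pos _).le).trans_eq (by ring)
  ring_nf

lemma abs_exp_mul_hN_sub_exp_mul_Hd_le_of_lt_fluctuation (hc0 : 0 < c)
    (hc : c ≤ 1 + 2 * θ * (v - γ d)) {g : Fin (n + 1) → ℝ}
    (hY : c < 4 * (1 + 2 * |θ|) * fluctuation (d.removeNth γ) v (d.removeNth g)) :
    |Real.exp (θ * (n + 1) * hN γ g) - Real.exp (θ * Hd γ v d g)| ≤
      4 * (1 + 2 * |θ|) / c * (Real.exp ((1 - c / 4) / 2 * g d ^ 2) *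
        (fluctuation (d.removeNth γ) v (d.removeNth g) *
          Real.exp (θ * (n + 1) * hN (d.removeNth γ) (d.removeNth g)))) +
      4 * (1 + 2 * |θ|) / c * (fluctuation (d.removeNth γ) v (d.removeNth g) *
        Real.exp (θ * (n + 1) * hN γ g)) := by
  rw [exp_mul_Hd_eq_mul]
  set Y := fluctuation (d.removeNth γ) v (d.removeNth g)
  set M := Real.exp (θ * (n + 1) * hN (d.removeNth γ) (d.removeNth g))
  set W := Real.exp (θ * (n + 1) * hN γ g)
  set k := Real.exp ((1 - c / 4) / 2 * g d ^ 2)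
  have hone : 1 ≤ 4 * (1 + 2 * |θ|) / c * Y := by
    rw [div_mul_eq_mul_div, one_le_div hc0]
    exact hY.le
  have hk : Real.exp (-(θ * (v - γ d) * g d ^ 2)) ≤ k := by
    rw [Real.exp_le_exp, ← neg_mul]
    exact mul_le_mul_of_nonneg_right (by linarith) (sq_nonneg _)
  calc |W - Real.exp (-(θ * (v - γ d) * g d ^ 2)) * M| ≤ k * M + W := by
        rw [abs_sub_comm]
        refine (abs_sub _ _).trans ?_
        rw [abs_of_pos (by positivity), abs_of_pos (Real.exp_pos _)]
        gcongr
    _ ≤ 4 * (1 + 2 * |θ|) / c * Y * (k * M + W) := le_mul_of_one_le_left (by positivity) hone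
    _ = _ := by ring

lemma abs_exp_mul_hN_sub_exp_mul_Hd_le (hc0 : 0 < c) (hc1 : c ≤ 1)
    (hc : c ≤ 1 + 2 * θ * (v - γ d)) (hB : |v - γ d| ≤ B) (g : Fin (n + 1) → ℝ) :
    |Real.exp (θ * (n + 1) * hN γ g) - Real.exp (θ * Hd γ v d g)| ≤
      (2 * |θ| * (1 + B) * (16 / c) ^ 2 + 4 * (1 + 2 * |θ|) / c) *
        (Real.exp ((1 - c / 4) / 2 * g d ^ 2) *
          (fluctuation (d.removeNth γ) v (d.removeNth g) *
            Real.exp (θ * (n + 1) * hN (d.removeNth γ) (d.removeNth g)))) +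
      4 * (1 + 2 * |θ|) / c * (fluctuation (d.removeNth γ) v (d.removeNth g) *
        Real.exp (θ * (n + 1) * hN γ g)) := by
  have hB0 : 0 ≤ B := (abs_nonneg _).trans hB
  have hY0 := (fluctuation_pos (d.removeNth γ) v (d.removeNth g)).le
  rw [add_mul, add_assoc]
  rcases le_or_gt (4 * (1 + 2 * |θ|) * fluctuation (d.removeNth γ) v (d.removeNth g)) c with hY | hY
  · exact (abs_exp_mul_hN_sub_exp_mul_Hd_le_of_fluctuation_le hc0 hc1 hc hB hY).trans
      (le_add_of_nonneg_right (by positivity))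
  · exact (abs_exp_mul_hN_sub_exp_mul_Hd_le_of_lt_fluctuation hc0 hc hY).trans
      (le_add_of_nonneg_left (by positivity))

end Weights

section Transfer

/-- The event that the squared norm of `n` spins is at least about half of its typical value `n`.
On it, the energy contributed by a further spin `x` is at most a constant times `x²`. -/
def bulk (n : ℕ) : Set (Fin n → ℝ) := {y | ((n : ℝ) + 1) / 2 ≤ normSq y}

lemma measurableSet_bulk (n : ℕ) : MeasurableSet (bulk n) :=
  measurableSet_le measurable_const measurable_normSq

variable {n : ℕ} {B θ v : ℝ} {γ : Fin (n + 1) → ℝ} {d : Fin (n + 1)} {u : (Fin n → ℝ) → ℝ}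

lemma exp_neg_mul_exp_le_exp_mul_hN (hγ : ∀ i, |γ i| ≤ B) {g : Fin (n + 1) → ℝ}
    (hg : d.removeNth g ∈ bulk n) :
    Real.exp (-(4 * |θ| * B * g d ^ 2)) *
        Real.exp (θ * (n + 1) * hN (d.removeNth γ) (d.removeNth g)) ≤
      Real.exp (θ * (n + 1) * hN γ g) := by
  have hB : 0 ≤ B := (abs_nonneg _).trans (hγ d)
  rw [exp_mul_hN_eq_mul (θ * (n + 1)) γ d g, mul_comm]
  set hbar := hN (d.removeNth γ) (d.removeNth g)
  refine mul_le_mul_of_nonneg_left (Real.exp_le_exp.2 (neg_le_neg ?_)) (Real.exp_pos _).le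
  have hshare : (n + 1) * overlap d g ≤ 2 * g d ^ 2 := by
    have hnorm : ((n : ℝ) + 1) / 2 ≤ normSq g :=
      hg.trans (le_of_le_of_eq (le_add_of_nonneg_left (sq_nonneg _)) (normSq_eq_sq_add d g).symm)
    rw [← overlap_mul_normSq d g]
    linarith [mul_le_mul_of_nonneg_left hnorm (overlap_nonneg d g)]
  have hforce : θ * (hbar - γ d) ≤ |θ| * (2 * B) :=
    ((le_abs_self _).trans_eq (abs_mul _ _)).trans
      (mul_le_mul_of_nonneg_left (abs_hN_removeNth_sub_le hγ d _) (abs_nonneg θ))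
  calc θ * (n + 1) * (overlap d g * (hbar - γ d))
      = (n + 1) * overlap d g * (θ * (hbar - γ d)) := by ring
    _ ≤ (n + 1) * overlap d g * (|θ| * (2 * B)) :=
        mul_le_mul_of_nonneg_left hforce (mul_nonneg (by positivity) (overlap_nonneg d g))
    _ ≤ 2 * g d ^ 2 * (|θ| * (2 * B)) := mul_le_mul_of_nonneg_right hshare (by positivity)
    _ = _ := by ring

lemma integrable_removeNth (hu : Integrable u (stdNormal n)) :
    Integrable (fun g => u (d.removeNth g)) (stdNormal (n + 1)) := by
  simpa only [one_mul] using integrable_mul_removeNth (φ := fun _ => 1) (integrable_const _) hu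

lemma integral_indicator_mul_exp_le (hγ : ∀ i, |γ i| ≤ B)
    (hu : Integrable u (stdNormal n)) (hu0 : ∀ y, 0 ≤ u y) :
    ∫ y, (bulk n).indicator u y *
        Real.exp (θ * (n + 1) * hN (d.removeNth γ) y) ∂stdNormal n ≤
      √(1 + 8 * |θ| * B) *
        ∫ g, u (d.removeNth g) * Real.exp (θ * (n + 1) * hN γ g) ∂stdNormal (n + 1) := by
  have hB : 0 ≤ B := (abs_nonneg _).trans (hγ d)
  have hb : 0 < 1 + 2 * (4 * |θ| * B) := by positivity
  have hL : (∫ x, Real.exp (-(4 * |θ| * B * x ^ 2)) ∂gaussianReal 0 1)⁻¹ =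
      √(1 + 8 * |θ| * B) := by
    rw [integral_exp_neg_sq_gaussianReal hb, inv_inv]
    ring_nf
  rw [← hL, ← div_eq_inv_mul, le_div_iff₀' (integral_exp_pos
    (integrable_exp_neg_sq_gaussianReal hb)), ← integral_mul_removeNth (d := d)]
  refine integral_mono_of_nonneg (ae_of_all _ fun g => ?_)
    (integrable_mul_exp_hN (integrable_removeNth hu)) (ae_of_all _ fun g => ?_)
  · exact mul_nonneg (Real.exp_pos _).le
      (mul_nonneg (Set.indicator_nonneg (fun y _ => hu0 y) _) (Real.exp_pos _).le)
  · by_cases hg : d.removeNth g ∈ bulk n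
    · simp only [Set.indicator_of_mem hg]
      rw [mul_left_comm]
      exact mul_le_mul_of_nonneg_left (exp_neg_mul_exp_le_exp_mul_hN hγ hg) (hu0 _)
    · simp only [Set.indicator_of_notMem hg]
      rw [zero_mul, mul_zero]
      exact mul_nonneg (hu0 _) (Real.exp_pos _).le

lemma le_indicator_add_mul_sq (hn : 3 ≤ n) {C : ℝ} (hC : 0 ≤ C)
    (hu : ∀ y ∉ bulk n, u y ≤ C) (y : Fin n → ℝ) :
    u y ≤ (bulk n).indicator u y +
      9 * C * (normSq y / n - 1) ^ 2 := by
  by_cases hy : y ∈ bulk n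
  · rw [Set.indicator_of_mem hy]
    exact le_add_of_nonneg_right (by positivity)
  · rw [Set.indicator_of_notMem hy, zero_add]
    have hn' : (3 : ℝ) ≤ n := by exact_mod_cast hn
    have hratio : normSq y / n ≤ 2 / 3 := by
      rw [div_le_iff₀ (by linarith)]
      linarith [show normSq y < ((n : ℝ) + 1) / 2 from not_le.1 hy]
    refine (hu y hy).trans ?_
    have hsq : 1 ≤ 9 * (normSq y / n - 1) ^ 2 := by nlinarith
    exact (le_mul_of_one_le_right hC hsq).trans_eq (by ring)

lemma integral_normSq_div_sub_one_sq_mul_exp_hN (hn : 2 ≤ n) (κ : ℝ) (η : Fin n → ℝ) :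
    ∫ y, (normSq y / n - 1) ^ 2 * Real.exp (κ * hN η y) ∂stdNormal n =
      2 / (n : ℝ) * ∫ y, Real.exp (κ * hN η y) ∂stdNormal n := by
  obtain ⟨m, rfl⟩ := Nat.exists_eq_add_of_le' (one_le_two.trans hn)
  have : NeZero m := ⟨by omega⟩
  rw [integral_mul_exp_hN, Nat.cast_add_one, integral_normSq_div_sub_one_sq_gibbs, mul_comm]

lemma integral_mul_exp_hN_removeNth_le (hn : 3 ≤ n) (hγ : ∀ i, |γ i| ≤ B)
    (hu : Integrable u (stdNormal n)) (hu0 : ∀ y, 0 ≤ u y) {C : ℝ} (hC : 0 ≤ C)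
    (huC : ∀ y ∉ bulk n, u y ≤ C) :
    ∫ y, u y * Real.exp (θ * (n + 1) * hN (d.removeNth γ) y) ∂stdNormal n ≤
      √(1 + 8 * |θ| * B) *
        ∫ g, u (d.removeNth g) * Real.exp (θ * (n + 1) * hN γ g) ∂stdNormal (n + 1) +
      18 * C / n * ∫ y, Real.exp (θ * (n + 1) * hN (d.removeNth γ) y) ∂stdNormal n := by
  have hgood := integrable_mul_exp_hN (κ := θ * (n + 1)) (γ := d.removeNth γ)
    (hu.indicator (measurableSet_bulk n))
  have hbad := (integrable_mul_exp_hN (κ := θ * (n + 1)) (γ := d.removeNth γ)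
    (integrable_normSq_div_sub_one_sq (n := n) n)).const_mul (9 * C)
  calc _ ≤ ∫ y, ((bulk n).indicator u y *
          Real.exp (θ * (n + 1) * hN (d.removeNth γ) y) + 9 * C * ((normSq y / n - 1) ^ 2 *
          Real.exp (θ * (n + 1) * hN (d.removeNth γ) y))) ∂stdNormal n := by
        refine integral_mono (integrable_mul_exp_hN hu) (hgood.fun_add hbad) fun y => ?_
        refine (mul_le_mul_of_nonneg_right (le_indicator_add_mul_sq hn hC huC y)
          (Real.exp_pos _).le).trans_eq (by ring)
    _ ≤ _ := by
        rw [integral_add hgood hbad, integral_const_mul,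
          integral_normSq_div_sub_one_sq_mul_exp_hN (by omega)]
        exact (add_le_add_left (integral_indicator_mul_exp_le hγ hu hu0) _).trans_eq (by ring)

lemma integral_exp_hN_removeNth_le (hn : 36 ≤ n) (hγ : ∀ i, |γ i| ≤ B) :
    ∫ y, Real.exp (θ * (n + 1) * hN (d.removeNth γ) y) ∂stdNormal n ≤
      2 * √(1 + 8 * |θ| * B) * ∫ g, Real.exp (θ * (n + 1) * hN γ g) ∂stdNormal (n + 1) := by
  have hn' : (36 : ℝ) ≤ n := by exact_mod_cast hn
  have htransfer := integral_mul_exp_hN_removeNth_le (θ := θ) (d := d) (u := fun _ => 1)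
    (by omega) hγ (integrable_const _) (fun _ => zero_le_one) zero_le_one fun _ _ => le_rfl
  simp only [one_mul, mul_one] at htransfer
  have hsmall : 18 / (n : ℝ) ≤ 1 / 2 := by
    rw [div_le_iff₀ (by linarith)]
    linarith
  have habsorb := mul_le_mul_of_nonneg_right hsmall
    (integral_exp_hN_pos (θ * (n + 1)) (d.removeNth γ)).le
  linarith

lemma integrable_fluctuation (η : Fin n → ℝ) (v : ℝ) :
    Integrable (fluctuation η v) (stdNormal n) := by
  have henergy : Integrable (fun y => hN η y - v) (stdNormal n) :=
    (Integrable.of_bound (by fun_prop) _ (ae_of_all _ fun y => abs_hN_le_sum η y)).sub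
      (integrable_const v)
  have hnorm : Integrable (fun y : Fin n → ℝ => normSq y / (n + 1) - 1) (stdNormal n) := by
    simpa using ((integrable_normSq_pow 1).div_const ((n : ℝ) + 1)).sub' (integrable_const 1)
  exact (henergy.abs.add hnorm.abs).add (integrable_const _)

lemma fluctuation_le_of_notMem_bulk (hγ : ∀ i, |γ i| ≤ B) {y : Fin n → ℝ} (hy : y ∉ bulk n) :
    fluctuation (d.removeNth γ) v y ≤ B + |v| + 2 := by
  have henergy : |hN (d.removeNth γ) y - v| ≤ B + |v| :=
    (abs_sub _ _).trans (add_le_add_left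
      (abs_hN_le ((abs_nonneg _).trans (hγ d)) (fun j => hγ (d.succAbove j)) y) _)
  have hn : (0 : ℝ) < n + 1 := n.cast_add_one_pos
  have hy' : normSq y < ((n : ℝ) + 1) / 2 := not_le.1 hy
  have hnorm : |normSq y / (n + 1) - 1| ≤ 1 := by
    rw [abs_le]
    constructor
    · linarith [div_nonneg (normSq_nonneg y) hn.le]
    · linarith [(div_le_iff₀ hn).2 (by linarith : normSq y ≤ 2 * (n + 1))]
  have hone : 1 / ((n : ℝ) + 1) ≤ 1 := div_le_one_of_le₀ (by simp) hn.le
  unfold fluctuation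
  linarith

lemma integral_exp_hN_le_integral_fluctuation_mul (v κ : ℝ) (γ : Fin (n + 1) → ℝ)
    (d : Fin (n + 1)) :
    1 / ((n : ℝ) + 1) * ∫ g, Real.exp (κ * hN γ g) ∂stdNormal (n + 1) ≤
      ∫ g, fluctuation (d.removeNth γ) v (d.removeNth g) *
        Real.exp (κ * hN γ g) ∂stdNormal (n + 1) := by
  rw [← integral_const_mul]
  exact integral_mono ((integrable_exp_hN _ γ).const_mul _)
    (integrable_mul_exp_hN (integrable_removeNth (integrable_fluctuation _ v)))
    fun g => mul_le_mul_of_nonneg_right (one_div_le_fluctuation _ v _) (Real.exp_pos _).le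

lemma integral_fluctuation_mul_exp_hN_removeNth_le (hn : 36 ≤ n) (hγ : ∀ i, |γ i| ≤ B) (v : ℝ) :
    ∫ y, fluctuation (d.removeNth γ) v y *
        Real.exp (θ * (n + 1) * hN (d.removeNth γ) y) ∂stdNormal n ≤
      √(1 + 8 * |θ| * B) * (1 + 72 * (B + |v| + 2)) *
        ∫ g, fluctuation (d.removeNth γ) v (d.removeNth g) *
          Real.exp (θ * (n + 1) * hN γ g) ∂stdNormal (n + 1) := by
  have hB : 0 ≤ B := (abs_nonneg _).trans (hγ d)
  have hn' : (36 : ℝ) ≤ n := by exact_mod_cast hn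
  have htransfer := integral_mul_exp_hN_removeNth_le (θ := θ) (d := d)
    (u := fluctuation (d.removeNth γ) v) (by omega) hγ (integrable_fluctuation _ v)
    (fun y => (fluctuation_pos _ v y).le) (by positivity) fun _ => fluctuation_le_of_notMem_bulk hγ
  set IY := ∫ g, fluctuation (d.removeNth γ) v (d.removeNth g) *
    Real.exp (θ * (n + 1) * hN γ g) ∂stdNormal (n + 1)
  set Z := ∫ g, Real.exp (θ * (n + 1) * hN γ g) ∂stdNormal (n + 1)
  set C := B + |v| + 2
  have : 0 ≤ C := by positivity
  have hZ : Z ≤ (n + 1) * IY := by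
    have h := integral_exp_hN_le_integral_fluctuation_mul v (θ * (n + 1)) γ d
    rwa [one_div_mul_eq_div, div_le_iff₀' (by linarith)] at h
  have hratio : ((n : ℝ) + 1) / n ≤ 2 := by
    rw [div_le_iff₀ (by linarith)]
    linarith
  have hIY : 0 ≤ IY := integral_nonneg fun g =>
    mul_nonneg (fluctuation_pos _ v _).le (Real.exp_pos _).le
  calc _ ≤ √(1 + 8 * |θ| * B) * IY +
        18 * C / n * (2 * √(1 + 8 * |θ| * B) * ((n + 1) * IY)) := by
        refine htransfer.trans (add_le_add_right (mul_le_mul_of_nonneg_left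
          ((integral_exp_hN_removeNth_le hn hγ).trans ?_) (by positivity)) _)
        gcongr
    _ = √(1 + 8 * |θ| * B) * (1 + 36 * C * (((n : ℝ) + 1) / n)) * IY := by ring
    _ ≤ √(1 + 8 * |θ| * B) * (1 + 36 * C * 2) * IY := by gcongr
    _ = _ := by ring

end Transfer

section WeightedMean

variable {α : Type*} [MeasurableSpace α] {μ : Measure α} {w w' f : α → ℝ} {S : ℝ}

lemma abs_inv_mul_integral_mul_le (hw0 : ∀ x, 0 ≤ w x) (hw : Integrable w μ)
    (hZ : 0 < ∫ x, w x ∂μ) (hS : ∀ x, |f x| ≤ S) :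
    |(∫ x, w x ∂μ)⁻¹ * ∫ x, f x * w x ∂μ| ≤ S := by
  rw [abs_mul, abs_of_pos (inv_pos.2 hZ), inv_mul_le_iff₀ hZ, mul_comm, ← integral_const_mul]
  refine norm_integral_le_of_norm_le (f := fun x => f x * w x) (hw.const_mul S)
    (ae_of_all _ fun x => ?_)
  rw [norm_mul, Real.norm_eq_abs, Real.norm_of_nonneg (hw0 x)]
  exact mul_le_mul_of_nonneg_right (hS x) (hw0 x)

lemma abs_integral_mul_sub_integral_mul_le (hw : Integrable w μ) (hw' : Integrable w' μ)
    (hf : AEMeasurable f μ) (hS : ∀ x, |f x| ≤ S) :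
    |∫ x, f x * w x ∂μ - ∫ x, f x * w' x ∂μ| ≤ S * ∫ x, |w x - w' x| ∂μ := by
  rw [← integral_sub (hw.bdd_mul hf.aestronglyMeasurable (ae_of_all _ hS))
    (hw'.bdd_mul hf.aestronglyMeasurable (ae_of_all _ hS)), ← integral_const_mul]
  refine norm_integral_le_of_norm_le (f := fun x => f x * w x - f x * w' x)
    ((hw.sub hw').abs.const_mul S) (ae_of_all _ fun x => ?_)
  rw [← mul_sub, norm_mul, Real.norm_eq_abs, Real.norm_eq_abs]
  exact mul_le_mul_of_nonneg_right (hS x) (abs_nonneg _)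

lemma abs_inv_mul_integral_mul_sub_le (hw0' : ∀ x, 0 ≤ w' x)
    (hw : Integrable w μ) (hw' : Integrable w' μ) (hZ : 0 < ∫ x, w x ∂μ)
    (hZ' : 0 < ∫ x, w' x ∂μ) (hf : AEMeasurable f μ) (hS : ∀ x, |f x| ≤ S) :
    |(∫ x, w x ∂μ)⁻¹ * ∫ x, f x * w x ∂μ - (∫ x, w' x ∂μ)⁻¹ * ∫ x, f x * w' x ∂μ| ≤
      2 * S * ((∫ x, w x ∂μ)⁻¹ * ∫ x, |w x - w' x| ∂μ) := by
  have hmean := abs_inv_mul_integral_mul_le hw0' hw' hZ' hS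
  have hnumerator := abs_integral_mul_sub_integral_mul_le hw hw' hf hS
  have hpartition : |∫ x, w x ∂μ - ∫ x, w' x ∂μ| ≤ ∫ x, |w x - w' x| ∂μ := by
    rw [← integral_sub hw hw']
    exact abs_integral_le_integral_abs
  set Z := ∫ x, w x ∂μ
  set Z' := ∫ x, w' x ∂μ
  set m := Z'⁻¹ * ∫ x, f x * w' x ∂μ with hm
  have hsplit : Z⁻¹ * ∫ x, f x * w x ∂μ - m =
      Z⁻¹ * ((∫ x, f x * w x ∂μ - ∫ x, f x * w' x ∂μ) - m * (Z - Z')) := by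
    rw [hm]
    field_simp
    ring
  rw [hsplit, abs_mul, abs_of_pos (inv_pos.2 hZ), mul_left_comm]
  refine mul_le_mul_of_nonneg_left ((abs_sub _ _).trans ?_) (inv_pos.2 hZ).le
  rw [abs_mul, two_mul, add_mul]
  exact add_le_add hnumerator
    (mul_le_mul hmean hpartition (abs_nonneg _) ((abs_nonneg _).trans hmean))

end WeightedMean

section Factorization

variable {n : ℕ} {θ v : ℝ} {γ : Fin (n + 1) → ℝ} {d : Fin (n + 1)}

lemma integral_mul_exp_mul_Hd (hpos : 0 < 1 + 2 * θ * (v - γ d)) (φ : ℝ → ℝ)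
    (ψ : (Fin n → ℝ) → ℝ) :
    ∫ g, φ (g d) * ψ (d.removeNth g) * Real.exp (θ * Hd γ v d g) ∂stdNormal (n + 1) =
      (√(1 + 2 * θ * (v - γ d)))⁻¹ *
        (∫ x, φ x ∂gaussianReal 0 (Real.toNNReal (1 / (1 + 2 * θ * (v - γ d))))) *
        ∫ y, ψ y * Real.exp (θ * (n + 1) * hN (d.removeNth γ) y) ∂stdNormal n := by
  have hb : 1 + 2 * θ * (v - γ d) = 1 + 2 * (θ * (v - γ d)) := by ring
  rw [hb] at hpos ⊢
  rw [← integral_mul_exp_neg_sq_gaussianReal hpos, ← integral_mul_removeNth (d := d)]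
  congr 1 with g
  rw [exp_mul_Hd_eq_mul]
  ring

lemma gibbsMean_Hd_mul (hpos : 0 < 1 + 2 * θ * (v - γ d)) (φ : ℝ → ℝ)
    (ψ : ({i : Fin (n + 1) // i ≠ d} → ℝ) → ℝ) :
    gibbsMean θ (Hd γ v d) (fun g => φ (g d) * ψ (fun i => g i)) =
      (∫ x, φ x ∂gaussianReal 0 (Real.toNNReal (1 / (1 + 2 * θ * (v - γ d))))) *
        gibbsMean θ (Hd γ v d) (fun g => ψ (fun i => g i)) := by
  obtain ⟨ψ', hψ⟩ : ∃ ψ' : (Fin n → ℝ) → ℝ,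
      ∀ g : Fin (n + 1) → ℝ, ψ (fun i => g i) = ψ' (d.removeNth g) := by
    refine ⟨fun y => ψ (fun i => d.insertNth (α := fun _ => ℝ) 0 y i), fun g => ?_⟩
    congr 1 with ⟨i, hi⟩
    obtain ⟨j, rfl⟩ := Fin.exists_succAbove_eq hi
    simp [Fin.removeNth]
  have hone := integral_mul_exp_mul_Hd hpos (fun _ => 1) ψ'
  simp only [one_mul, integral_const, probReal_univ, one_smul, mul_one] at hone
  simp only [gibbsMean, hψ]
  rw [integral_mul_exp_mul_Hd hpos φ ψ', hone]
  ring

end Factorization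

section Decoupling

variable {n : ℕ} {B c θ v : ℝ} {γ : Fin (n + 1) → ℝ} {d : Fin (n + 1)}

lemma integral_abs_exp_mul_hN_sub_exp_mul_Hd_le (hc0 : 0 < c) (hc1 : c ≤ 1)
    (hc : c ≤ 1 + 2 * θ * (v - γ d)) (hB : |v - γ d| ≤ B) :
    ∫ g, |Real.exp (θ * (n + 1) * hN γ g) - Real.exp (θ * Hd γ v d g)| ∂stdNormal (n + 1) ≤
      (2 * |θ| * (1 + B) * (16 / c) ^ 2 + 4 * (1 + 2 * |θ|) / c) * ((√(c / 4))⁻¹ *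
        ∫ y, fluctuation (d.removeNth γ) v y *
          Real.exp (θ * (n + 1) * hN (d.removeNth γ) y) ∂stdNormal n) +
      4 * (1 + 2 * |θ|) / c * ∫ g, fluctuation (d.removeNth γ) v (d.removeNth g) *
        Real.exp (θ * (n + 1) * hN γ g) ∂stdNormal (n + 1) := by
  have hexp : ∀ x : ℝ, Real.exp ((1 - c / 4) / 2 * x ^ 2) =
      Real.exp (-(-((1 - c / 4) / 2) * x ^ 2)) := fun x => by rw [neg_mul, neg_neg]
  have hprec : 1 + 2 * -((1 - c / 4) / 2) = c / 4 := by ring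
  have hb : 0 < 1 + 2 * -((1 - c / 4) / 2) := by linarith
  have hspin : Integrable (fun x => Real.exp ((1 - c / 4) / 2 * x ^ 2)) (gaussianReal 0 1) := by
    simpa only [hexp] using integrable_exp_neg_sq_gaussianReal hb
  have hbar : Integrable (fun y => fluctuation (d.removeNth γ) v y *
      Real.exp (θ * (n + 1) * hN (d.removeNth γ) y)) (stdNormal n) :=
    integrable_mul_exp_hN (integrable_fluctuation _ v)
  have hdecoupled := (integrable_mul_removeNth (d := d) hspin hbar).const_mul
    (2 * |θ| * (1 + B) * (16 / c) ^ 2 + 4 * (1 + 2 * |θ|) / c)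
  have hcoupled := (integrable_mul_exp_hN (κ := θ * (n + 1)) (γ := γ)
    (integrable_removeNth (d := d) (integrable_fluctuation (d.removeNth γ) v))).const_mul
    (4 * (1 + 2 * |θ|) / c)
  refine (integral_mono_of_nonneg (ae_of_all _ fun g => abs_nonneg _)
    (hdecoupled.fun_add hcoupled) (ae_of_all _ fun g =>
      abs_exp_mul_hN_sub_exp_mul_Hd_le hc0 hc1 hc hB g)).trans_eq ?_
  rw [integral_add hdecoupled hcoupled, integral_const_mul, integral_const_mul,
    integral_mul_removeNth (fun x => Real.exp ((1 - c / 4) / 2 * x ^ 2)) fun y =>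
      fluctuation (d.removeNth γ) v y * Real.exp (θ * (n + 1) * hN (d.removeNth γ) y)]
  simp only [hexp]
  rw [integral_exp_neg_sq_gaussianReal hb, hprec]

lemma exists_integral_abs_exp_mul_hN_sub_exp_mul_Hd_le (θ v : ℝ) (hc0 : 0 < c) (hB : 0 ≤ B) :
    ∃ K, 0 ≤ K ∧ ∀ (n : ℕ) (γ : Fin (n + 1) → ℝ) (d : Fin (n + 1)), 36 ≤ n →
      (∀ i, |γ i| ≤ B) → c ≤ 1 + 2 * θ * (v - γ d) →
      ∫ g, |Real.exp (θ * (n + 1) * hN γ g) - Real.exp (θ * Hd γ v d g)| ∂stdNormal (n + 1) ≤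
        K * ∫ g, fluctuation (d.removeNth γ) v (d.removeNth g) *
          Real.exp (θ * (n + 1) * hN γ g) ∂stdNormal (n + 1) := by
  set c' := min c 1
  have hc0' : 0 < c' := lt_min hc0 one_pos
  set E := 4 * (1 + 2 * |θ|) / c'
  set C := 2 * |θ| * (1 + (|v| + B)) * (16 / c') ^ 2 + E
  refine ⟨C * ((√(c' / 4))⁻¹ * (√(1 + 8 * |θ| * B) * (1 + 72 * (B + |v| + 2)))) + E,
    by positivity, fun n γ d hn hγ hc => ?_⟩
  refine (integral_abs_exp_mul_hN_sub_exp_mul_Hd_le hc0' (min_le_right _ _)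
    ((min_le_left _ _).trans hc)
    ((abs_sub _ _).trans (add_le_add_right (hγ d) |v|))).trans ?_
  rw [add_mul (C * _) E, mul_assoc C, mul_assoc (√(c' / 4))⁻¹]
  gcongr
  exact integral_fluctuation_mul_exp_hN_removeNth_le hn hγ v

lemma exists_abs_gibbsMean_sub_gibbsMean_le_of_le (θ v : ℝ) (hc0 : 0 < c) (hB : 0 ≤ B) :
    ∃ K, 0 ≤ K ∧ ∀ (n : ℕ) (γ : Fin (n + 1) → ℝ) (d : Fin (n + 1)), 36 ≤ n →
      (∀ i, |γ i| ≤ B) → c ≤ 1 + 2 * θ * (v - γ d) → ∀ (f : (Fin (n + 1) → ℝ) → ℝ) (S : ℝ),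
      AEMeasurable f (stdNormal (n + 1)) → (∀ g, |f g| ≤ S) →
      |gibbsMean θ (HN γ) f - gibbsMean θ (Hd γ v d) f| ≤
        K * S * (1 / √((n + 1 : ℕ) : ℝ) + √(gibbsMean θ (HN γ) fun g => (hN γ g - v) ^ 2)) := by
  obtain ⟨K, hK, hweights⟩ := exists_integral_abs_exp_mul_hN_sub_exp_mul_Hd_le θ v hc0 hB
  refine ⟨2 * K * (5 + (2 * B + 1) * (3 + 2 * |θ|) / c), by positivity,
    fun n γ d hn hγ hc f S hf hS => ?_⟩
  have : NeZero n := ⟨by omega⟩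
  have hS0 : 0 ≤ S := (abs_nonneg _).trans (hS 0)
  have hint := integrable_exp_hN (θ * (n + 1)) γ
  have hintd := integrable_exp_mul_Hd (hc0.trans_le hc)
  have hfluct := integral_fluctuation_removeNth_le hγ d hc0 hc
  have hweights := hweights n γ d hn hγ hc
  rw [integral_mul_exp_hN fun g => fluctuation (d.removeNth γ) v (d.removeNth g)] at hweights
  rw [gibbsMean_HN θ fun g => (hN γ g - v) ^ 2, Nat.cast_add_one]
  set q := 1 / √((n : ℝ) + 1) + √(∫ g, (hN γ g - v) ^ 2 ∂gibbs γ (θ * (n + 1)))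
  simp only [gibbsMean, HN_eq_mul_hN, Nat.cast_add_one, ← mul_assoc θ]
  refine (abs_inv_mul_integral_mul_sub_le (fun g => (Real.exp_pos _).le) hint hintd
    (integral_exp_pos hint) (integral_exp_pos hintd) hf hS).trans ?_
  have hZ := integral_exp_pos hint
  set Z := ∫ g, Real.exp (θ * (n + 1) * hN γ g) ∂stdNormal (n + 1)
  calc _ ≤ 2 * S * (Z⁻¹ *
        (K * (Z * ((5 + (2 * B + 1) * (3 + 2 * |θ|) / c) * q)))) := by
        gcongr
        exact hweights.trans (by gcongr)
    _ = _ := by field_simp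

lemma abs_gibbsMean_sub_gibbsMean_le_two_mul (hpos : 0 < 1 + 2 * θ * (v - γ d))
    {f : (Fin (n + 1) → ℝ) → ℝ} {S : ℝ} (hS : ∀ g, |f g| ≤ S) :
    |gibbsMean θ (HN γ) f - gibbsMean θ (Hd γ v d) f| ≤ 2 * S := by
  have hint : Integrable (fun g => Real.exp (θ * HN γ g)) (stdNormal (n + 1)) := by
    simpa only [HN_eq_mul_hN, ← mul_assoc] using integrable_exp_hN _ γ
  have hintd := integrable_exp_mul_Hd hpos
  refine (abs_sub _ _).trans ((add_le_add ?_ ?_).trans_eq (two_mul S).symm)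
  · exact abs_inv_mul_integral_mul_le (fun g => (Real.exp_pos _).le) hint
      (integral_exp_pos hint) hS
  · exact abs_inv_mul_integral_mul_le (fun g => (Real.exp_pos _).le) hintd
      (integral_exp_pos hintd) hS

lemma exists_abs_gibbsMean_sub_gibbsMean_le (θ v : ℝ) (hc0 : 0 < c) (hB : 0 ≤ B) :
    ∃ K, 0 < K ∧ ∀ (N : ℕ) (γ : Fin N → ℝ) (d : Fin N), (∀ i, |γ i| ≤ B) →
      c ≤ 1 + 2 * θ * (v - γ d) → ∀ (f : (Fin N → ℝ) → ℝ) (S : ℝ),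
      AEMeasurable f (stdNormal N) → (∀ g, |f g| ≤ S) →
      |gibbsMean θ (HN γ) f - gibbsMean θ (Hd γ v d) f| ≤
        K * S * (1 / √(N : ℝ) + √(gibbsMean θ (HN γ) fun g => (hN γ g - v) ^ 2)) := by
  obtain ⟨K, hK, hlarge⟩ := exists_abs_gibbsMean_sub_gibbsMean_le_of_le θ v hc0 hB
  refine ⟨K + 14, by positivity, fun N γ d hγ hc f S hf hS => ?_⟩
  obtain _ | n := N
  · exact d.elim0
  have hS0 : 0 ≤ S := (abs_nonneg _).trans (hS 0)
  rcases le_or_gt 36 n with hn | hn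
  · refine (hlarge n γ d hn hγ hc f S hf hS).trans ?_
    gcongr
    linarith
  have hsqrt : √((n + 1 : ℕ) : ℝ) ≤ 7 := by
    rw [Real.sqrt_le_iff]
    exact ⟨by norm_num, by exact_mod_cast (by omega : n + 1 ≤ 7 ^ 2)⟩
  have hinv : 1 / 7 ≤ 1 / √((n + 1 : ℕ) : ℝ) :=
    one_div_le_one_div_of_le (Real.sqrt_pos.2 (Nat.cast_pos.2 n.succ_pos)) hsqrt
  calc _ ≤ 2 * S := abs_gibbsMean_sub_gibbsMean_le_two_mul (hc0.trans_le hc) hS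
    _ = 14 * S * (1 / 7) := by ring
    _ ≤ _ := by
        gcongr
        · linarith
        · exact hinv.trans (le_add_of_nonneg_right (Real.sqrt_nonneg _))

end Decoupling

end SphericalModel

theorem theorem1_general (θ v B : ℝ) {c : ℝ} (hc0 : 0 < c) :
    (∃ K : ℝ, 0 < K ∧ ∀ (N : ℕ) (γ : Fin N → ℝ) (d : Fin N) (f : (Fin N → ℝ) → ℝ),
      (∀ i, |γ i| ≤ B) → c ≤ 1 + 2 * θ * (v - γ d) →
      AEMeasurable f (stdNormal N) → (∃ C : ℝ, ∀ g, |f g| ≤ C) →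
        |gibbsMean θ (HN γ) f - gibbsMean θ (Hd γ v d) f| ≤
          K * (⨆ g, |f g|) *
            (1 / √(N : ℝ) + √(gibbsMean θ (HN γ) fun g => (hN γ g - v) ^ 2))) ∧
    (∀ (N : ℕ) (γ : Fin N → ℝ) (d : Fin N), 0 < 1 + 2 * θ * (v - γ d) →
      Integrable (fun g => Real.exp (θ * Hd γ v d g)) (stdNormal N) ∧
      ∀ (φ : ℝ → ℝ) (ψ : ({i : Fin N // i ≠ d} → ℝ) → ℝ), Measurable φ → Measurable ψ →
        (∃ C : ℝ, ∀ x, |φ x| ≤ C) → (∃ C : ℝ, ∀ y, |ψ y| ≤ C) →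
        gibbsMean θ (Hd γ v d) (fun g => φ (g d) * ψ (fun i => g i)) =
          (∫ x, φ x ∂gaussianReal 0 (Real.toNNReal (1 / (1 + 2 * θ * (v - γ d))))) *
          gibbsMean θ (Hd γ v d) (fun g => ψ (fun i => g i))) := by
  constructor
  · obtain ⟨K, hK, hbound⟩ := exists_abs_gibbsMean_sub_gibbsMean_le θ v hc0 (abs_nonneg B)
    exact ⟨K, hK, fun N γ d f hγ hc hf ⟨C, hC⟩ => hbound N γ d
      (fun i => (hγ i).trans (le_abs_self B)) hc f _ hf
      fun g => le_ciSup (f := fun g => |f g|) ⟨C, Set.forall_mem_range.2 hC⟩ g⟩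
  · rintro (_ | n) γ d hpos
    · exact d.elim0
    · exact ⟨integrable_exp_mul_Hd hpos, fun φ ψ _ _ _ _ => gibbsMean_Hd_mul hpos φ ψ⟩

theorem theorem1 (γt : ℝ) (hγt : 0 < γt) (γ : (N : ℕ) → Fin N → ℝ)
    (ρ : Measure ℝ) [IsProbabilityMeasure ρ] (hγ : EigenvalueHypothesis γt γ ρ)
    (θ : ℝ) (hθ : θ ∈ highTemp γt ρ) :
    (∃ K : ℝ, 0 < K ∧ ∀ (N : ℕ) (d : Fin N) (f : (Fin N → ℝ) → ℝ),
      AEMeasurable f (stdNormal N) → (∃ C : ℝ, ∀ g, |f g| ≤ C) →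
        |gibbsMean θ (HN (γ N)) f - gibbsMean θ (Hd (γ N) (vlim γt ρ θ) d) f| ≤
          K * (⨆ g, |f g|) * (1 / √(N : ℝ) + √(aN γt ρ (γ N) θ))) ∧
    (∀ (N : ℕ) (d : Fin N),
      0 < 1 + 2 * θ * (vlim γt ρ θ - γ N d) ∧
      Integrable (fun g => Real.exp (θ * Hd (γ N) (vlim γt ρ θ) d g)) (stdNormal N) ∧
      ∀ (φ : ℝ → ℝ) (ψ : ({i : Fin N // i ≠ d} → ℝ) → ℝ), Measurable φ → Measurable ψ →
        (∃ C : ℝ, ∀ x, |φ x| ≤ C) → (∃ C : ℝ, ∀ y, |ψ y| ≤ C) →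
        gibbsMean θ (Hd (γ N) (vlim γt ρ θ) d) (fun g => φ (g d) * ψ (fun i => g i)) =
          (∫ x, φ x ∂gaussianReal 0
            (Real.toNNReal (1 / (1 + 2 * θ * (vlim γt ρ θ - γ N d))))) *
          gibbsMean θ (Hd (γ N) (vlim γt ρ θ) d) (fun g => ψ (fun i => g i))) := by
  obtain ⟨c, hc0, hc⟩ := exists_precision_lower_bound hθ
  obtain ⟨⟨K, hK, hbound⟩, hfactor⟩ := theorem1_general θ (vlim γt ρ θ) γt hc0
  have habs : ∀ N i, |γ N i| ≤ γt := fun N i =>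
    (abs_of_nonneg (hγ.mem_Icc N i).1).trans_le (hγ.mem_Icc N i).2
  have hprec : ∀ N d, c ≤ 1 + 2 * θ * (vlim γt ρ θ - γ N d) := fun N d => hc _ (hγ.mem_Icc N d)
  exact ⟨⟨K, hK, fun N d f => hbound N (γ N) d f (habs N) (hprec N d)⟩,
    fun N d => ⟨hc0.trans_le (hprec N d), hfactor N (γ N) d (hc0.trans_le (hprec N d))⟩⟩
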